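/- **Theorem (All buckets filled with high probability).** Let $w\ge 2$ be an integer and $B>0$ real. Partition $[-B/2,B/2)$ into the $w$ half-open buckets $\mathcal I_i=[-B/2+i\,B/w,\,-B/2+(i+1)B/w)$, $0\le i<w$. Phase A processes numbers $s_1,s_2,\dots$ as follows. Start with $A_0=\{0\}$. Given $A_{j-1}$, form the list of all $x$ and all $x+s_j$ with $x\in A_{j-1}$, discard the elements outside $[-B/2,B/2)$, and let $A_j$ consist of one element per nonempty bucket, chosen uniformly at random among the listed elements in that bucket (with fresh independent randomness, independent of the $s_j$). For $\delta\in(0,1)$ put $$j_{\mathrm{half}}:=\lfloor 4\ln(w-1)\rfloor,\qquad t_\delta:=\left\lceil\frac{\ln(w/(2\delta))}{\ln(8/7)}\right\rceil,\qquad j_\delta:=j_{\mathrm{half}}+t_\delta .$$ There is an absolute constant $C>0$ such that the following holds for all such $w$ and $B$. 1. *(Filling.)* If $s_1,s_2,\dots$ are i.i.d. uniform on $(-B,B)$, then for every $\delta\in(0,1)$ and every $j\ge j_\delta$ one has $\Pr(|A_j|<w)\le\delta$, and $$j_\delta\le 4\ln w+\frac{\ln(w/(2\delta))}{\ln(8/7)}+1\le\Bigl(4+\frac1{\ln(8/7)}\Bigr)\ln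 w+\frac{\ln(1/\delta)}{\ln(8/7)}+1\le 11.489\ln w+7.489\ln(1/\delta)+1 .$$ Moreover there is an iteration index $j\le 7.96\log_2 w+5.19\log_2(1/\delta)+1$ with $\Pr(|A_j|<w)\le\delta$. 2. *(Mesh.)* For all values of the input and of the random choices and for every $n$: every element of $A_n$ is a subset sum of $s_1,\dots,s_n$, and if $|A_n|=w$ then every bucket contains an element of $A_n$, and every point of $[-B/2,B/2]$ is within $B/w$ of an element of $A_n$. 3. *(Time and state.)* Always $|A_n|\le w$. On a unit-cost random-access machine over the reals (arithmetic, comparison, rounding down, memory access, loop iteration, and reading the next input or random number each cost one unit of time), an explicit program for Phase A computes $A_n$ in time at most $C\,w\,(n+1)$ using at most $C\,w$ memory cells. In particular, for $n=j_\delta$, and also for $n=j$ with some index $j$ as in the last sentence of item 1, the time is at most $C\,(1+\log_2(1/\delta))\,w\log_2 w$, which is $O(w\log w)$ for fixed $\delta$. -/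

import Mathlib

open MeasureTheory ProbabilityTheory

universe u

/-! ### The random process of Phase A -/

/-- The `i`-th of the `w` half-open buckets of width `B / w` that partition `[-B/2, B/2)`. -/
def bucket (w : ℕ) (B : ℝ) (i : Fin w) : Set ℝ :=
  Set.Ico (-B / 2 + (i : ℝ) * (B / w)) (-B / 2 + ((i : ℝ) + 1) * (B / w))

/-- A trimmed state: for every bucket, the element kept there, if any. -/
abbrev Beam (w : ℕ) : Type := Fin w → Option ℝ

/-- The kept elements, listed by bucket. -/
def Beam.toList {w : ℕ} (A : Beam w) : List ℝ := (List.finRange w).filterMap A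

/-- The set of anchors of a state. -/
def Beam.anchors {w : ℕ} (A : Beam w) : Set ℝ := {a | ∃ i, A i = some a}

/-- Include / exclude the next number `s`: all `x` and all `x + s`. -/
def Beam.expand {w : ℕ} (A : Beam w) (s : ℝ) : List ℝ :=
  A.toList ++ A.toList.map (fun x => x + s)

open scoped Classical in
/-- The elements of the expanded list that lie in bucket `i`. -/
noncomputable def Beam.candidates {w : ℕ} (B : ℝ) (A : Beam w) (s : ℝ) (i : Fin w) : List ℝ :=
  (A.expand s).filter (fun x => x ∈ bucket w B i)

/-- The entry of `l` selected by `r`, and `none` if `l` is empty. For `r` uniform on `[0, 1]` every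
position of `l` is selected with the same probability. -/
noncomputable def pick (r : ℝ) (l : List ℝ) : Option ℝ :=
  l[min ⌊r * (l.length : ℝ)⌋₊ (l.length - 1)]?

/-- One iteration: expand by `s`, then keep one random candidate in each nonempty bucket. -/
noncomputable def Beam.step {w : ℕ} (B : ℝ) (A : Beam w) (s : ℝ) (r : Fin w → ℝ) : Beam w :=
  fun i => pick (r i) (A.candidates B s i)

open scoped Classical in
/-- The state after `j` iterations, started from `{0}`. The numbers are `s 0, s 1, …`; iteration
`j + 1` uses the number `s j` and, for bucket `i`, the random number `r (j * w + i)`. -/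
noncomputable def phaseA (w : ℕ) (B : ℝ) (s r : ℕ → ℝ) : ℕ → Beam w
  | 0 => fun i => if (0 : ℝ) ∈ bucket w B i then some 0 else none
  | j + 1 => (phaseA w B s r j).step B (s j) (fun i => r (j * w + i))

/-- `s 0, s 1, …` are uniform on `[-B, B]`, `r 0, r 1, …` are uniform on `[0, 1]`, and all these
variables together are independent. -/
structure IsPhaseAInput {Ω : Type u} [MeasurableSpace Ω] (P : Measure Ω) (B : ℝ)
    (s r : ℕ → Ω → ℝ) : Prop where
  measurable_s : ∀ j, Measurable (s j)
  measurable_r : ∀ k, Measurable (r k)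
  uniform_s : ∀ j, pdf.IsUniform (s j) (Set.Icc (-B) B) P volume
  uniform_r : ∀ k, pdf.IsUniform (r k) (Set.Icc 0 1) P volume
  indep : iIndepFun (Sum.elim s r : ℕ ⊕ ℕ → Ω → ℝ) P

/-- Every point of `[-B/2, B/2]` is within `ε` of `A`. -/
def IsMesh (A : Set ℝ) (B ε : ℝ) : Prop :=
  ∀ x ∈ Set.Icc (-B / 2) (B / 2), ∃ a ∈ A, |x - a| ≤ ε

/-! ### The iteration counts -/

/-- The explicit half-coverage index: the solution `t = 4 ln (w - 1)` of
`1 / (1 + (w - 1) exp (-t / 4)) = 1 / 2`, rounded down to an integer. -/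
noncomputable def jHalf (w : ℕ) : ℕ := ⌊4 * Real.log ((w : ℝ) - 1)⌋₊

noncomputable def tDelta (w : ℕ) (δ : ℝ) : ℕ :=
  ⌈Real.log ((w : ℝ) / (2 * δ)) / Real.log (8 / 7)⌉₊

noncomputable def jDelta (w : ℕ) (δ : ℝ) : ℕ := jHalf w + tDelta w δ

/-! ### A unit-cost random-access machine over the reals

Every arithmetic operation, comparison, rounding, memory access, loop iteration and input access
costs one unit of time. The two inputs (the numbers and the random numbers) are read-once streams.
The space used is one more than the largest memory address accessed. -/

structure RAM where
  mem : ℕ → ℝ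
  time : ℕ
  space : ℕ
  /-- the stream of input numbers that have not been read yet is `items itemPos, …` -/
  items : ℕ → ℝ
  itemPos : ℕ
  /-- the stream of random numbers that have not been read yet is `coins coinPos, …` -/
  coins : ℕ → ℝ
  coinPos : ℕ

abbrev Prog (α : Type) : Type := StateM RAM α

namespace Prog

def tick : Prog Unit := modify fun m => { m with time := m.time + 1 }

/-- A register operation with result `a`. -/
def op {α : Type} (a : α) : Prog α := do
  tick
  return a

noncomputable def add (x y : ℝ) : Prog ℝ := op (x + y)

noncomputable def mul (x y : ℝ) : Prog ℝ := op (x * y)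

noncomputable def div (x y : ℝ) : Prog ℝ := op (x / y)

noncomputable def neg (x : ℝ) : Prog ℝ := op (-x)

noncomputable def le (x y : ℝ) : Prog Bool := op (decide (x ≤ y))

noncomputable def lt (x y : ℝ) : Prog Bool := op (decide (x < y))

noncomputable def floor (x : ℝ) : Prog ℕ := op ⌊x⌋₊

def minNat (k l : ℕ) : Prog ℕ := op (min k l)

def predNat (k : ℕ) : Prog ℕ := op (k - 1)

def load (a : ℕ) : Prog ℝ := do
  tick
  modify fun m => { m with space := max m.space (a + 1) }
  return (← get).mem a

def store (a : ℕ) (x : ℝ) : Prog Unit := do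
  tick
  modify fun m => { m with mem := Function.update m.mem a x, space := max m.space (a + 1) }

def readItem : Prog ℝ := do
  tick
  let m ← get
  set { m with itemPos := m.itemPos + 1 }
  return m.items m.itemPos

def readCoin : Prog ℝ := do
  tick
  let m ← get
  set { m with coinPos := m.coinPos + 1 }
  return m.coins m.coinPos

/-- `for i = 0, …, n - 1 do body i` -/
def forLoop : ℕ → (ℕ → Prog Unit) → Prog Unit
  | 0, _ => return ()
  | n + 1, body => do
    forLoop n body
    tick
    body n

/-! The memory holds a record of six cells for each bucket `i`: `6 * i` is a flag (`1` if an anchor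
is kept, else `0`), `6 * i + 1` the anchor, `6 * i + 2` the number of candidates, and
`6 * i + 3, 6 * i + 4, 6 * i + 5` the candidates. (Anchors of three different buckets are more than
one bucket width apart, so that a bucket never gets more than three candidates.) -/

/-- Append `x` to the candidates of its bucket, and discard it if it lies outside `[-B/2, B/2)`.
Here `h = B / 2` and `Δ = B / w`. -/
noncomputable def place (h Δ x : ℝ) : Prog Unit := do
  let h' ← neg h
  if ← le h' x then
    if ← lt x h then
      let y ← add x h
      let q ← div y Δ
      let i ← floor q
      let c ← load (6 * i + 2)
      let k ← floor c
      store (6 * i + 3 + k) x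
      let c' ← add c 1
      store (6 * i + 2) c'

noncomputable def setup (w : ℕ) (h Δ : ℝ) : Prog Unit := do
  forLoop w fun i => store (6 * i) 0
  let q ← div h Δ
  let i ← floor q
  store (6 * i) 1
  store (6 * i + 1) 0

/-- The anchors become the first candidates of their buckets. -/
noncomputable def keepOld (w : ℕ) : Prog Unit :=
  forLoop w fun i => do
    let f ← load (6 * i)
    if ← lt 0 f then
      let a ← load (6 * i + 1)
      store (6 * i + 3) a
      store (6 * i + 2) 1
    else
      store (6 * i + 2) 0

/-- The shifted anchors are distributed to the buckets. -/
noncomputable def placeShifted (w : ℕ) (h Δ s : ℝ) : Prog Unit :=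
  forLoop w fun i => do
    let f ← load (6 * i)
    if ← lt 0 f then
      let a ← load (6 * i + 1)
      let x ← add a s
      place h Δ x

/-- One random candidate is kept in each nonempty bucket. -/
noncomputable def trim (w : ℕ) : Prog Unit :=
  forLoop w fun i => do
    let r ← readCoin
    let c ← load (6 * i + 2)
    if ← lt 0 c then
      let y ← mul r c
      let k ← floor y
      let n ← floor c
      let n' ← predNat n
      let k' ← minNat k n'
      let a ← load (6 * i + 3 + k')
      store (6 * i + 1) a
      store (6 * i) 1

/-- `n` iterations of Phase A. -/
noncomputable def program (w : ℕ) (B : ℝ) (n : ℕ) : Prog Unit := do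
  let h ← div B 2
  let Δ ← div B w
  setup w h Δ
  forLoop n fun _ => do
    let s ← readItem
    keepOld w
    placeShifted w h Δ s
    trim w

end Prog

/-- The machine after `n` iterations on the numbers `s` and the random numbers `r`. -/
noncomputable def runPhaseA (w : ℕ) (B : ℝ) (s r : ℕ → ℝ) (n : ℕ) : RAM :=
  (StateT.run (Prog.program w B n)
    { mem := fun _ => 0, time := 0, space := 0,
      items := s, itemPos := 0, coins := r, coinPos := 0 } : Id (Unit × RAM)).2

/-- The state of Phase A that is stored in the memory. -/
noncomputable def RAM.beam (w : ℕ) (m : RAM) : Beam w :=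
  fun i => if m.mem (6 * i) = 0 then none else some (m.mem (6 * i + 1))

/-!
Write a number in `[-B, B)` as `s = -B + k * (B / w) + θ` with `k < 2 * w` and `0 ≤ θ < B / w`. For
fixed `θ`, shifting the `N` kept elements by `θ` moves them into `K ≥ N / 2` distinct cells, and
every empty bucket is reached from these cells for exactly `K` of the `2 * w` values of `k`. A
uniform `s` therefore fills `(w - N) * K / (2 * w)` new buckets on average. A function `V` of the
number of occupied buckets that decreases suitably with every newly filled bucket then contracts in
expectation by a constant factor in every iteration, and Markov's inequality for `V` bounds the
probability that a bucket is still empty. The ratio `(w - N) / N` contracts at rate `1 / 6` and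
gives the bound with base-2 logarithms; a potential that involves square roots contracts at rate
`1 / 8` and gives the bound for `j_δ`.

The machine stays within constant time and memory per bucket because the shifted elements that fall
into one bucket come from two adjacent buckets: with the old element, a bucket never has more than
three candidates.
-/

/-! ### Cells and buckets -/

section Cell

variable {w : ℕ} {B : ℝ}

/-- The index of the cell of width `B / w` that contains `x`, where the line is cut into half-open
cells of this width; the cells `0, …, w - 1` are the buckets. -/
noncomputable def cell (w : ℕ) (B x : ℝ) : ℤ := ⌊(x + B / 2) / (B / w)⌋

theorem mem_bucket_iff_cell_eq (hB : 0 < B) (i : Fin w) (x : ℝ) :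
    x ∈ bucket w B i ↔ cell w B x = (i : ℕ) := by
  have hw : (0 : ℝ) < w := by exact_mod_cast i.pos
  have hΔ : 0 < B / w := by positivity
  rw [cell, Int.floor_eq_iff, le_div_iff₀ hΔ, div_lt_iff₀ hΔ, bucket, Set.mem_Ico]
  push_cast
  constructor <;> rintro ⟨h1, h2⟩ <;> constructor <;> linarith

theorem mem_Ico_iff_cell (hB : 0 < B) (hw : 0 < w) (x : ℝ) :
    x ∈ Set.Ico (-(B / 2)) (B / 2) ↔ 0 ≤ cell w B x ∧ cell w B x < w := by
  have hw' : (0 : ℝ) < w := by exact_mod_cast hw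
  have hΔ : 0 < B / w := by positivity
  rw [cell, Int.floor_nonneg, Int.floor_lt, Set.mem_Ico, Int.cast_natCast, div_lt_iff₀ hΔ,
    mul_div_cancel₀ _ hw'.ne', le_div_iff₀ hΔ, zero_mul]
  constructor <;> rintro ⟨h1, h2⟩ <;> constructor <;> linarith

theorem cell_mono (hB : 0 ≤ B) : Monotone (cell w B) := fun x y h =>
  Int.floor_le_floor (by gcongr)

theorem cell_add_intCast_mul (hB : B ≠ 0) (hw : w ≠ 0) (x : ℝ) (k : ℤ) :
    cell w B (x + k * (B / w)) = cell w B x + k := by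
  rw [cell, cell, ← Int.floor_add_intCast]
  congr 1
  field_simp
  ring

theorem exists_mem_bucket (hB : 0 < B) (hw : 0 < w) {x : ℝ}
    (hx : x ∈ Set.Ico (-(B / 2)) (B / 2)) : ∃ i, x ∈ bucket w B i := by
  obtain ⟨h0, h1⟩ := (mem_Ico_iff_cell hB hw x).1 hx
  exact ⟨⟨(cell w B x).toNat, by omega⟩, (mem_bucket_iff_cell_eq hB _ x).2 (by simp [h0])⟩

theorem eq_of_mem_bucket (hB : 0 < B) {i j : Fin w} {x : ℝ} (hi : x ∈ bucket w B i)
    (hj : x ∈ bucket w B j) : i = j := by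
  rw [mem_bucket_iff_cell_eq hB] at hi hj
  exact Fin.ext (by omega)

theorem abs_sub_le_of_mem_bucket {i : Fin w} {x y : ℝ} (hx : x ∈ bucket w B i)
    (hy : y ∈ bucket w B i) : |x - y| ≤ B / w := by
  obtain ⟨hx₁, hx₂⟩ := hx
  obtain ⟨hy₁, hy₂⟩ := hy
  exact abs_le.2 ⟨by linarith, by linarith⟩

theorem zero_mem_Ico_half (hB : 0 < B) : (0 : ℝ) ∈ Set.Ico (-(B / 2)) (B / 2) :=
  ⟨by linarith, by linarith⟩

theorem isMesh_of_forall_bucket {S : Set ℝ} (hB : 0 < B) (hw : 0 < w)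
    (h : ∀ i : Fin w, ∃ a ∈ S, a ∈ bucket w B i) : IsMesh S B (B / w) := by
  rintro x ⟨hx, hx'⟩
  rcases hx'.lt_or_eq with hlt | rfl
  · obtain ⟨i, hi⟩ := exists_mem_bucket hB hw (x := x) ⟨by linarith, hlt⟩
    obtain ⟨a, ha, hai⟩ := h i
    exact ⟨a, ha, abs_sub_le_of_mem_bucket hi hai⟩
  · obtain ⟨a, ha, ha₁, ha₂⟩ := h ⟨w - 1, by omega⟩
    have hlast : w * (B / w) = B := mul_div_cancel₀ _ (by positivity)
    simp only [Nat.cast_sub hw, Nat.cast_succ, Nat.cast_zero] at ha₁ ha₂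
    exact ⟨a, ha, abs_le.2 ⟨by linarith, by linarith⟩⟩

end Cell

/-! ### States -/

theorem pick_eq_none_iff {r : ℝ} {l : List ℝ} : pick r l = none ↔ l = [] := by
  rw [pick, List.getElem?_eq_none_iff, ← List.length_eq_zero_iff]
  omega

theorem mem_of_pick_eq_some {r a : ℝ} {l : List ℝ} (h : pick r l = some a) : a ∈ l :=
  List.mem_of_getElem? h

namespace Beam

variable {w : ℕ} {B : ℝ} {A : Beam w}

/-- Every kept element lies in the bucket it is kept for. -/
def Consistent (B : ℝ) (A : Beam w) : Prop := ∀ i a, A i = some a → a ∈ bucket w B i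

/-- The set of occupied buckets. Its size is `|A|`, and unlike `Beam.anchors` it does not depend on
the random choices in the last iteration. -/
def occ (A : Beam w) : Finset (Fin w) := Finset.univ.filter fun i => (A i).isSome

theorem mem_occ {i : Fin w} : i ∈ A.occ ↔ ∃ a, A i = some a := by
  simp [occ, Option.isSome_iff_exists]

theorem mem_toList {x : ℝ} : x ∈ A.toList ↔ ∃ i, A i = some x := by
  simp [toList]

theorem mem_candidates {s x : ℝ} {i : Fin w} :
    x ∈ A.candidates B s i ↔
      (∃ b a, A b = some a ∧ (x = a ∨ x = a + s)) ∧ x ∈ bucket w B i := by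
  simp only [candidates, expand, List.mem_filter, List.mem_append, List.mem_map, mem_toList,
    decide_eq_true_eq]
  grind

theorem consistent_step (B : ℝ) (A : Beam w) (s : ℝ) (r : Fin w → ℝ) :
    (A.step B s r).Consistent B :=
  fun _ _ h => (mem_candidates.1 (mem_of_pick_eq_some h)).2

namespace Consistent

theorem eq_of_mem_bucket (hA : A.Consistent B) (hB : 0 < B) {b i : Fin w} {a : ℝ}
    (hb : A b = some a) (ha : a ∈ bucket w B i) : b = i :=
  _root_.eq_of_mem_bucket hB (hA b a hb) ha

theorem mem_occ_step (hA : A.Consistent B) (hB : 0 < B) {s : ℝ} {r : Fin w → ℝ} {i : Fin w} :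
    i ∈ (A.step B s r).occ ↔ i ∈ A.occ ∨ ∃ b a, A b = some a ∧ a + s ∈ bucket w B i := by
  have hne : i ∈ (A.step B s r).occ ↔ ∃ x, x ∈ A.candidates B s i := by
    rw [mem_occ, ← Option.ne_none_iff_exists', step, Ne, pick_eq_none_iff,
      List.eq_nil_iff_forall_not_mem, not_forall_not]
  simp only [hne, mem_candidates, mem_occ]
  constructor
  · rintro ⟨x, ⟨b, a, hb, rfl | rfl⟩, hx⟩
    · exact Or.inl ⟨x, hA.eq_of_mem_bucket hB hb hx ▸ hb⟩
    · exact Or.inr ⟨b, a, hb, hx⟩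
  · rintro (⟨a, ha⟩ | ⟨b, a, hb, hx⟩)
    · exact ⟨a, ⟨i, a, ha, Or.inl rfl⟩, hA i a ha⟩
    · exact ⟨a + s, ⟨b, a, hb, Or.inr rfl⟩, hx⟩

theorem eq_none_of_candidates_eq_nil (hA : A.Consistent B) {s : ℝ} {i : Fin w}
    (h : A.candidates B s i = []) : A i = none := by
  rw [Option.eq_none_iff_forall_ne_some]
  intro a ha
  have hmem : a ∈ A.candidates B s i := mem_candidates.2 ⟨⟨i, a, ha, Or.inl rfl⟩, hA i a ha⟩
  simp [h] at hmem

theorem ncard_anchors (hA : A.Consistent B) (hB : 0 < B) : A.anchors.ncard = A.occ.card := by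
  have himage : A.anchors = (fun i => (A i).getD 0) '' (A.occ : Set (Fin w)) := by
    ext a
    simp only [anchors, Set.mem_ofPred_eq, Set.mem_image, Finset.mem_coe, mem_occ]
    constructor
    · rintro ⟨i, hi⟩
      exact ⟨i, ⟨a, hi⟩, by simp [hi]⟩
    · rintro ⟨i, ⟨a', hi⟩, rfl⟩
      exact ⟨i, by simp [hi]⟩
  rw [himage, Set.InjOn.ncard_image, Set.ncard_coe_finset]
  intro i hi j hj hij
  obtain ⟨a, ha⟩ := mem_occ.1 hi
  obtain ⟨b, hb⟩ := mem_occ.1 hj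
  simp only [ha, hb, Option.getD_some] at hij
  exact hA.eq_of_mem_bucket hB ha (hij ▸ hA j b hb)

theorem ncard_anchors_le (hA : A.Consistent B) (hB : 0 < B) : A.anchors.ncard ≤ w := by
  simpa only [hA.ncard_anchors hB, Fintype.card_fin] using A.occ.card_le_univ

theorem exists_anchor_mem_bucket (hA : A.Consistent B) (hB : 0 < B) (hfull : A.anchors.ncard = w)
    (i : Fin w) : ∃ a ∈ A.anchors, a ∈ bucket w B i := by
  have huniv : A.occ = Finset.univ :=
    (Finset.card_eq_iff_eq_univ _).1 (by rw [← hA.ncard_anchors hB, hfull, Fintype.card_fin])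
  obtain ⟨a, ha⟩ := mem_occ.1 (huniv ▸ Finset.mem_univ i)
  exact ⟨a, ⟨i, ha⟩, hA i a ha⟩

end Consistent

end Beam

section PhaseA

variable {w : ℕ} {B : ℝ}

theorem phaseA_zero_eq_some_iff {s r : ℕ → ℝ} {i : Fin w} {a : ℝ} :
    phaseA w B s r 0 i = some a ↔ (0 : ℝ) ∈ bucket w B i ∧ a = 0 := by
  simp [phaseA, eq_comm]

theorem consistent_phaseA (w : ℕ) (B : ℝ) (s r : ℕ → ℝ) (n : ℕ) :
    (phaseA w B s r n).Consistent B := by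
  cases n with
  | zero =>
    intro i a h
    obtain ⟨h0, rfl⟩ := phaseA_zero_eq_some_iff.1 h
    exact h0
  | succ n => exact Beam.consistent_step _ _ _ _

theorem card_occ_phaseA_zero (hB : 0 < B) (hw : 0 < w) (s r : ℕ → ℝ) :
    (phaseA w B s r 0).occ.card = 1 := by
  obtain ⟨i, hi⟩ := exists_mem_bucket hB hw (zero_mem_Ico_half hB)
  refine Finset.card_eq_one.2 ⟨i, Finset.eq_singleton_iff_unique_mem.2 ⟨?_, fun j hj => ?_⟩⟩
  · exact Beam.mem_occ.2 ⟨0, phaseA_zero_eq_some_iff.2 ⟨hi, rfl⟩⟩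
  · obtain ⟨a, ha⟩ := Beam.mem_occ.1 hj
    exact eq_of_mem_bucket hB (phaseA_zero_eq_some_iff.1 ha).1 hi

theorem card_occ_phaseA_pos (hB : 0 < B) (hw : 0 < w) (s r : ℕ → ℝ) (n : ℕ) :
    0 < (phaseA w B s r n).occ.card := by
  induction n with
  | zero => simp [card_occ_phaseA_zero hB hw]
  | succ n ih =>
    obtain ⟨i, hi⟩ := Finset.card_pos.1 ih
    exact Finset.card_pos.2
      ⟨i, ((consistent_phaseA w B s r n).mem_occ_step hB).2 (Or.inl hi)⟩

theorem exists_eq_sum_of_mem_anchors_phaseA {s r : ℕ → ℝ} {n : ℕ} {a : ℝ}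
    (ha : a ∈ (phaseA w B s r n).anchors) :
    ∃ V : Finset ℕ, V ⊆ Finset.range n ∧ a = ∑ k ∈ V, s k := by
  induction n generalizing a with
  | zero =>
    obtain ⟨i, hi⟩ := ha
    exact ⟨∅, by simp, by simpa using (phaseA_zero_eq_some_iff.1 hi).2⟩
  | succ n ih =>
    obtain ⟨i, hi⟩ := ha
    obtain ⟨⟨b, x, hb, hx⟩, -⟩ := Beam.mem_candidates.1 (mem_of_pick_eq_some hi)
    obtain ⟨V, hV, rfl⟩ := ih ⟨b, hb⟩
    have hV' := hV.trans (Finset.range_mono n.le_succ)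
    rcases hx with rfl | rfl
    · exact ⟨V, hV', rfl⟩
    · have hn : n ∉ V := fun h => by simpa using hV h
      exact ⟨insert n V, Finset.insert_subset (by simp) hV',
        by rw [Finset.sum_insert hn, add_comm]⟩

theorem phaseA_congr {s r s' r' : ℕ → ℝ} {n : ℕ} (hs : ∀ k < n, s k = s' k)
    (hr : ∀ k < n * w, r k = r' k) : phaseA w B s r n = phaseA w B s' r' n := by
  induction n with
  | zero => rfl
  | succ n ih =>
    have hsucc : n * w + w = (n + 1) * w := by ring
    rw [phaseA, phaseA, ih (fun k hk => hs k (by omega)) (fun k hk => hr k (by omega)),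
      hs n (by omega)]
    congr 1
    funext i
    exact hr _ (by have := i.isLt; omega)

end PhaseA

/-! ### The number of newly occupied buckets -/

section Shift

variable {w : ℕ}

/-- The buckets outside `O` that are hit when the cells in `D` are shifted by `k - w`. Shifts by
`k - w` with `k < 2 * w` are exactly those by which a cell can meet a bucket. -/
def newlyHit (O : Finset (Fin w)) (D : Finset ℕ) (k : ℕ) : Finset (Fin w) :=
  Oᶜ.filter fun i => ∃ c ∈ D, c + k = i + w

theorem card_filter_exists_add_eq {D : Finset ℕ} {m n : ℕ} (hD : ∀ c ∈ D, c ≤ m) (hm : m < n) :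
    ((Finset.range n).filter fun k => ∃ c ∈ D, c + k = m).card = D.card := by
  have himage : ((Finset.range n).filter fun k => ∃ c ∈ D, c + k = m) = D.image (m - ·) := by
    ext k
    simp only [Finset.mem_filter, Finset.mem_range, Finset.mem_image]
    exact ⟨fun ⟨_, c, hc, h⟩ => ⟨c, hc, by omega⟩,
      fun ⟨c, hc, h⟩ => ⟨by omega, c, hc, by have := hD c hc; omega⟩⟩
  rw [himage, Finset.card_image_of_injOn]
  intro c hc c' hc' h
  have := hD c hc
  have := hD c' hc'
  simp only at h
  omega

theorem sum_card_newlyHit (O : Finset (Fin w)) {D : Finset ℕ} (hD : ∀ c ∈ D, c ≤ w) :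
    ∑ k ∈ Finset.range (2 * w), (newlyHit O D k).card = (w - O.card) * D.card := by
  simp only [newlyHit, Finset.card_filter]
  rw [Finset.sum_comm]
  simp only [← Finset.card_filter]
  have hcount : ∀ i ∈ Oᶜ,
      ((Finset.range (2 * w)).filter fun k => ∃ c ∈ D, c + k = i + w).card = D.card := fun i _ =>
    card_filter_exists_add_eq (fun c hc => (hD c hc).trans (Nat.le_add_left _ _)) (by omega)
  rw [Finset.sum_congr rfl hcount, Finset.sum_const, Finset.card_compl, Fintype.card_fin,
    smul_eq_mul]

theorem card_newlyHit_le (O : Finset (Fin w)) (D : Finset ℕ) (k : ℕ) :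
    (newlyHit O D k).card ≤ D.card := by
  refine Finset.card_le_card_of_injOn (fun i => i + w - k) (fun i hi => ?_) fun i hi j hj hij => ?_
  · obtain ⟨-, c, hc, h⟩ := Finset.mem_filter.1 hi
    simpa only [Finset.mem_coe, (by omega : (i : ℕ) + w - k = c)] using hc
  · obtain ⟨-, c, -, h⟩ := Finset.mem_filter.1 hi
    obtain ⟨-, c', -, h'⟩ := Finset.mem_filter.1 hj
    simp only at hij
    exact Fin.ext (by omega)

theorem card_add_card_newlyHit_le (O : Finset (Fin w)) (D : Finset ℕ) (k : ℕ) :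
    O.card + (newlyHit O D k).card ≤ w := by
  calc O.card + (newlyHit O D k).card ≤ O.card + Oᶜ.card :=
        Nat.add_le_add_left (Finset.card_filter_le _ _) _
    _ = w := by rw [Finset.card_add_card_compl, Fintype.card_fin]

theorem card_le_two_mul_card_image {O : Finset (Fin w)} {e : Fin w → ℕ}
    (he : ∀ b ∈ O, e b = b ∨ e b = b + 1) : O.card ≤ 2 * (O.image e).card := by
  refine Finset.card_le_mul_card_image O 2 fun c _ => ?_
  have hsub : (O.filter fun b => e b = c).image (fun b : Fin w => (b : ℕ)) ⊆ {c, c - 1} := by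
    intro x hx
    obtain ⟨b, hb, rfl⟩ := Finset.mem_image.1 hx
    obtain ⟨hbO, hbc⟩ := Finset.mem_filter.1 hb
    have := he b hbO
    rw [Finset.mem_insert, Finset.mem_singleton]
    omega
  rw [← Finset.card_image_of_injective _ Fin.val_injective]
  exact (Finset.card_le_card hsub).trans Finset.card_le_two

theorem cell_add_eq_or {B x θ : ℝ} (hB : 0 < B) (hw : 0 < w) (h0 : 0 ≤ θ) (h1 : θ < B / w) :
    cell w B (x + θ) = cell w B x ∨ cell w B (x + θ) = cell w B x + 1 := by
  have hlower : cell w B x ≤ cell w B (x + θ) := cell_mono hB.le (by linarith)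
  have hupper : cell w B (x + θ) ≤ cell w B (x + (1 : ℤ) * (B / w)) :=
    cell_mono hB.le (by push_cast; linarith)
  rw [cell_add_intCast_mul hB.ne' hw.ne'] at hupper
  omega

namespace Beam

/-- The index of the cell that contains the element kept in bucket `b`, shifted by `θ`. -/
noncomputable def shiftedCell (B θ : ℝ) (A : Beam w) (b : Fin w) : ℕ :=
  (cell w B ((A b).getD 0 + θ)).toNat

namespace Consistent

variable {B θ : ℝ} {A : Beam w}

theorem cell_add_eq_or (hA : A.Consistent B) (hB : 0 < B) (h0 : 0 ≤ θ) (h1 : θ < B / w)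
    {b : Fin w} {a : ℝ} (hb : A b = some a) :
    cell w B (a + θ) = (b : ℕ) ∨ cell w B (a + θ) = (b : ℕ) + 1 := by
  rw [← (mem_bucket_iff_cell_eq hB b a).1 (hA b a hb)]
  exact _root_.cell_add_eq_or hB b.pos h0 h1

theorem shiftedCell_eq_or (hA : A.Consistent B) (hB : 0 < B) (h0 : 0 ≤ θ) (h1 : θ < B / w)
    {b : Fin w} (hb : b ∈ A.occ) :
    A.shiftedCell B θ b = b ∨ A.shiftedCell B θ b = b + 1 := by
  obtain ⟨a, ha⟩ := mem_occ.1 hb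
  have := hA.cell_add_eq_or hB h0 h1 ha
  rw [shiftedCell, ha, Option.getD_some]
  omega

theorem add_mem_bucket_iff (hA : A.Consistent B) (hB : 0 < B) (h0 : 0 ≤ θ) (h1 : θ < B / w)
    {b i : Fin w} {a : ℝ} (hb : A b = some a) (k : ℕ) :
    a + (-B + k * (B / w) + θ) ∈ bucket w B i ↔ A.shiftedCell B θ b + k = i + w := by
  have hw : (w : ℝ) ≠ 0 := by exact_mod_cast i.pos.ne'
  have hshift : a + (-B + k * (B / w) + θ) = a + θ + ((k - w : ℤ) : ℝ) * (B / w) := by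
    push_cast
    field_simp
    ring
  have := hA.cell_add_eq_or hB h0 h1 hb
  rw [mem_bucket_iff_cell_eq hB, hshift, cell_add_intCast_mul hB.ne' i.pos.ne', shiftedCell, hb,
    Option.getD_some]
  omega

theorem card_occ_step (hA : A.Consistent B) (hB : 0 < B) (h0 : 0 ≤ θ) (h1 : θ < B / w) (k : ℕ)
    (r : Fin w → ℝ) :
    (A.step B (-B + k * (B / w) + θ) r).occ.card =
      A.occ.card + (newlyHit A.occ (A.occ.image (A.shiftedCell B θ)) k).card := by
  have hdisj : Disjoint A.occ (newlyHit A.occ (A.occ.image (A.shiftedCell B θ)) k) :=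
    disjoint_compl_right.mono_right (Finset.filter_subset _ _)
  have hhit : ∀ i, (∃ b a, A b = some a ∧ a + (-B + k * (B / w) + θ) ∈ bucket w B i) ↔
      ∃ c ∈ A.occ.image (A.shiftedCell B θ), c + k = i + w := by
    intro i
    simp only [Finset.exists_mem_image, mem_occ]
    constructor
    · rintro ⟨b, a, hb, h⟩
      exact ⟨b, ⟨a, hb⟩, (hA.add_mem_bucket_iff hB h0 h1 hb k).1 h⟩
    · rintro ⟨b, ⟨a, hb⟩, h⟩
      exact ⟨b, a, hb, (hA.add_mem_bucket_iff hB h0 h1 hb k).2 h⟩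
  rw [← Finset.card_union_of_disjoint hdisj]
  congr 1
  ext i
  rw [hA.mem_occ_step hB, hhit, Finset.mem_union, newlyHit, Finset.mem_filter, Finset.mem_compl]
  tauto

end Consistent

end Beam

end Shift

/-! ### Measurability of the process -/

section Measurability

/-- A set of optional values is measurable if its preimage under `some` is, so that `none` is an
isolated point. -/
instance {α : Type*} [MeasurableSpace α] : MeasurableSpace (Option α) :=
  MeasurableSpace.map some inferInstance

/-- The coarsest structure for which all the partial entries `l[n]?` of a list are measurable. -/
instance {α : Type*} [MeasurableSpace α] : MeasurableSpace (List α) :=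
  MeasurableSpace.comap (fun l (n : ℕ) => l[n]?) MeasurableSpace.pi

variable {Ω α β ι : Type*} [MeasurableSpace Ω] [MeasurableSpace α] [MeasurableSpace β]

theorem measurable_option_some : Measurable (some : α → Option α) := fun _ h => h

theorem measurable_of_measurable_comp_some {f : Option α → β} (h : Measurable (f ∘ some)) :
    Measurable f := fun _ hs => h hs

theorem measurable_option_isSome : Measurable (Option.isSome : Option α → Bool) :=
  measurable_of_measurable_comp_some measurable_const

theorem measurable_option_getD (a : α) : Measurable fun o : Option α => o.getD a :=
  measurable_of_measurable_comp_some measurable_id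

theorem measurable_option_elim [Inhabited α] {o : Ω → Option α} {b : Ω → β} {f : Ω → α → β}
    (ho : Measurable o) (hb : Measurable b) (hf : Measurable (Function.uncurry f)) :
    Measurable fun ω => (o ω).elim (b ω) (f ω) := by
  have heq : (fun ω => (o ω).elim (b ω) (f ω)) =
      fun ω => if (o ω).isSome then f ω ((o ω).getD default) else b ω := by
    funext ω
    cases o ω <;> rfl
  rw [heq]
  exact Measurable.ite (measurable_option_isSome.comp ho (measurableSet_singleton true))
    (hf.comp (measurable_id.prodMk ((measurable_option_getD default).comp ho))) hb

theorem measurable_list_iff {l : Ω → List α} :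
    Measurable l ↔ ∀ n : ℕ, Measurable fun ω => (l ω)[n]? := by
  rw [measurable_comap_iff, measurable_pi_iff]
  rfl

theorem measurable_list_cons : Measurable fun p : α × List α => p.1 :: p.2 := by
  refine measurable_list_iff.2 fun n => ?_
  cases n with
  | zero => exact measurable_option_some.comp measurable_fst
  | succ n => exact (measurable_list_iff.1 measurable_id n).comp measurable_snd

theorem measurable_list_length : Measurable (List.length : List α → ℕ) := by
  refine measurable_of_Ioi fun n => ?_
  have hpre : List.length ⁻¹' Set.Ioi n = (fun l : List α => l[n]?.isSome) ⁻¹' {true} := by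
    ext l
    simp
  rw [hpre]
  exact measurable_option_isSome.comp (measurable_list_iff.1 measurable_id n)
    (measurableSet_singleton true)

theorem measurable_filterMap_append [Inhabited α] {f : ι → Ω → Option α} {l : Ω → List α}
    (hf : ∀ i, Measurable (f i)) (hl : Measurable l) (is : List ι) :
    Measurable fun ω => is.filterMap (f · ω) ++ l ω := by
  induction is with
  | nil => simpa using hl
  | cons i is ih =>
    have heq : (fun ω => (i :: is).filterMap (f · ω) ++ l ω) = fun ω => (f i ω).elim
        (is.filterMap (f · ω) ++ l ω) (· :: (is.filterMap (f · ω) ++ l ω)) := by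
      funext ω
      cases h : f i ω <;> simp [h]
    rw [heq]
    exact measurable_option_elim (hf i) ih
      (measurable_list_cons.comp (measurable_snd.prodMk (ih.comp measurable_fst)))

theorem measurable_pick : Measurable fun p : ℝ × List ℝ => pick p.1 p.2 := by
  have hlength : Measurable fun p : ℝ × List ℝ => p.2.length :=
    measurable_list_length.comp measurable_snd
  have hindex : Measurable fun p : ℝ × List ℝ =>
      min ⌊p.1 * (p.2.length : ℝ)⌋₊ (p.2.length - 1) :=
    (Nat.measurable_floor.comp (measurable_fst.mul (measurable_from_nat.comp hlength))).min
      ((measurable_from_nat (f := (· - 1))).comp hlength)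
  have hentry : Measurable fun q : ℕ × List ℝ => q.2[q.1]? :=
    measurable_from_prod_countable_right fun n => measurable_list_iff.1 measurable_id n
  exact hentry.comp (hindex.prodMk measurable_snd)

theorem measurable_option_filter {o : Ω → Option ℝ} (ho : Measurable o) {S : Set ℝ}
    [DecidablePred (· ∈ S)] (hS : MeasurableSet S) :
    Measurable fun ω => (o ω).filter (· ∈ S) := by
  refine (measurable_of_measurable_comp_some ?_ : Measurable (Option.filter (· ∈ S))).comp ho
  have heq : Option.filter (· ∈ S) ∘ some = fun x => if x ∈ S then some x else none := by
    funext x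
    simp [Option.filter]
  rw [heq]
  exact Measurable.ite hS measurable_option_some measurable_const

end Measurability

namespace Beam

variable {w : ℕ} {B : ℝ}

open scoped Classical in
theorem candidates_eq_append (A : Beam w) (s : ℝ) (i : Fin w) :
    A.candidates B s i =
      (List.finRange w).filterMap (fun b => (A b).filter (· ∈ bucket w B i)) ++
        (List.finRange w).filterMap
          (fun b => ((A b).map (· + s)).filter (· ∈ bucket w B i)) := by
  rw [candidates, expand, List.filter_append, toList, List.filter_filterMap, List.map_filterMap,
    List.filter_filterMap]

theorem measurable_candidates (i : Fin w) :
    Measurable fun p : Beam w × ℝ => p.1.candidates B p.2 i := by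
  classical
  have hA (b : Fin w) : Measurable fun p : Beam w × ℝ => p.1 b :=
    (measurable_pi_apply b).comp measurable_fst
  have hshift (b : Fin w) : Measurable fun p : Beam w × ℝ => (p.1 b).map (· + p.2) := by
    have heq : (fun p : Beam w × ℝ => (p.1 b).map (· + p.2)) =
        fun p => (p.1 b).elim none fun a => some (a + p.2) := by
      funext p
      cases p.1 b <;> rfl
    rw [heq]
    exact measurable_option_elim (hA b) measurable_const (measurable_option_some.comp
      (measurable_snd.add (measurable_snd.comp measurable_fst)))
  have hbucket : MeasurableSet (bucket w B i) := measurableSet_Ico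
  simp only [candidates_eq_append]
  refine measurable_filterMap_append (fun b => measurable_option_filter (hA b) hbucket) ?_ _
  simpa only [List.append_nil] using measurable_filterMap_append (l := fun _ => [])
    (fun b => measurable_option_filter (hshift b) hbucket) measurable_const (List.finRange w)

theorem measurable_step : Measurable fun p : Beam w × ℝ × (Fin w → ℝ) => p.1.step B p.2.1 p.2.2 :=
  measurable_pi_lambda _ fun i => by
    have hcoin : Measurable fun p : Beam w × ℝ × (Fin w → ℝ) => p.2.2 i := by fun_prop
    exact measurable_pick.comp (hcoin.prodMk ((measurable_candidates i).comp
      (measurable_fst.prodMk (measurable_fst.comp measurable_snd))))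

theorem measurable_card_occ : Measurable fun A : Beam w => A.occ.card := by
  simp only [occ, Finset.card_filter]
  exact Finset.measurable_sum _ fun i _ => Measurable.ite
    (measurable_option_isSome.comp (measurable_pi_apply i) (measurableSet_singleton true))
    measurable_const measurable_const

theorem measurable_card_occ_step (r : Fin w → ℝ) :
    Measurable fun p : Beam w × ℝ => (p.1.step B p.2 r).occ.card :=
  measurable_card_occ.comp (measurable_step.comp
    (measurable_fst.prodMk (measurable_snd.prodMk measurable_const)))

end Beam

theorem measurable_phaseA {w : ℕ} {B : ℝ} (n : ℕ) :
    Measurable fun p : (ℕ → ℝ) × (ℕ → ℝ) => phaseA w B p.1 p.2 n := by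
  induction n with
  | zero => exact measurable_const
  | succ n ih =>
    have hinput : Measurable fun p : (ℕ → ℝ) × (ℕ → ℝ) =>
        (p.1 n, fun i : Fin w => p.2 (n * w + i)) := by fun_prop
    exact Beam.measurable_step.comp (ih.prodMk hinput)

/-! ### Potentials -/

/-- A function `V` of the number of occupied buckets whose expectation contracts by the factor
`1 - ρ` in every iteration. In `decay`, `N` buckets are occupied, their elements lie in `K` distinct
cells after a shift by less than one cell width, and `F` empty buckets are hit. Averaging over the
`2 * w` shifts by whole cells replaces `F` by `K * (w - N) / (2 * w)`, which leaves
`V N * (1 - ρ)`. -/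
structure IsPotential (w : ℕ) (ρ : ℝ) (V : ℕ → ℝ) : Prop where
  rate_nonneg : 0 ≤ ρ
  rate_le_one : ρ ≤ 1
  nonneg : ∀ N, 0 ≤ V N
  full : V w = 0
  decay : ∀ N K F : ℕ, 1 ≤ N → N < w → N ≤ 2 * K → K ≤ N → F ≤ K → N + F ≤ w →
    V (N + F) ≤ V N * (1 - 2 * w * ρ * F / (K * (w - N)))

namespace IsPotential

variable {w : ℕ} {ρ : ℝ} {V : ℕ → ℝ}

theorem sum_newlyHit_le (hV : IsPotential w ρ V) {O : Finset (Fin w)} {D : Finset ℕ}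
    (hO : 1 ≤ O.card) (hD : ∀ c ∈ D, c ≤ w) (hOD : O.card ≤ 2 * D.card) (hDO : D.card ≤ O.card) :
    ∑ k ∈ Finset.range (2 * w), V (O.card + (newlyHit O D k).card) ≤
      2 * w * ((1 - ρ) * V O.card) := by
  have hle : O.card ≤ w := by simpa only [Fintype.card_fin] using O.card_le_univ
  rcases hle.eq_or_lt with heq | hlt
  · have hnone : ∀ k, (newlyHit O D k).card = 0 := fun k => by
      have := card_add_card_newlyHit_le O D k
      omega
    simp [hnone, heq, hV.full]
  have hD0 : (0 : ℝ) < D.card := by exact_mod_cast (by omega : 0 < D.card)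
  have hempty : (0 : ℝ) < w - O.card := sub_pos.2 (by exact_mod_cast hlt)
  have hsum : ∑ k ∈ Finset.range (2 * w), ((newlyHit O D k).card : ℝ) = (w - O.card) * D.card := by
    rw [← Nat.cast_sub hle]
    exact_mod_cast sum_card_newlyHit O hD
  calc ∑ k ∈ Finset.range (2 * w), V (O.card + (newlyHit O D k).card)
      ≤ ∑ k ∈ Finset.range (2 * w), (V O.card -
          V O.card * (2 * w * ρ / (D.card * (w - O.card))) * (newlyHit O D k).card) := by
        refine Finset.sum_le_sum fun k _ => (hV.decay _ _ _ hO hlt hOD hDO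
          (card_newlyHit_le O D k) (card_add_card_newlyHit_le O D k)).trans_eq ?_
        ring
    _ = 2 * w * ((1 - ρ) * V O.card) := by
        rw [Finset.sum_sub_distrib, ← Finset.mul_sum, hsum, Finset.sum_const, Finset.card_range]
        field_simp
        ring

theorem pred_le (hV : IsPotential w ρ V) {N : ℕ} (h1 : 1 ≤ N) (hN : N < w) : V (w - 1) ≤ V N := by
  have hanti : ∀ M, N ≤ M → M < w → V M ≤ V N := by
    intro M hNM
    induction M, hNM using Nat.le_induction with
    | base => exact fun _ => le_rfl
    | succ M hNM ih =>
      intro hM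
      have hdecay := hV.decay M M 1 (by omega) (by omega) (by omega) le_rfl (by omega) hM.le
      refine hdecay.trans ((mul_le_of_le_one_right (hV.nonneg M) ?_).trans (ih (by omega)))
      have : (0 : ℝ) ≤ w - M := sub_nonneg.2 (by exact_mod_cast (by omega : M ≤ w))
      have := hV.rate_nonneg
      exact sub_le_self _ (by positivity)
  exact hanti (w - 1) (by omega) (by omega)

end IsPotential

/-! ### The expected potential -/

theorem setLIntegral_Ico_eq_sum (f : ℝ → ENNReal) (a : ℝ) {d : ℝ} (hd : 0 ≤ d) (n : ℕ) :
    ∫⁻ x in Set.Ico a (a + n * d), f x =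
      ∑ k ∈ Finset.range n, ∫⁻ θ in Set.Ico 0 d, f (a + k * d + θ) := by
  induction n with
  | zero => simp
  | succ n ih =>
    have hnd : 0 ≤ n * d := by positivity
    have hsplit : Set.Ico a (a + (n + 1 : ℕ) * d) =
        Set.Ico a (a + n * d) ∪ Set.Ico (a + n * d) (a + n * d + d) := by
      rw [Set.Ico_union_Ico_eq_Ico (by linarith) (by linarith)]
      push_cast
      ring_nf
    have hpreimage : (fun θ => a + n * d + θ) ⁻¹' Set.Ico (a + n * d) (a + n * d + d) =
        Set.Ico 0 d := by
      ext θ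
      simp
    rw [hsplit, lintegral_union measurableSet_Ico Set.Ico_disjoint_Ico_same, ih,
      Finset.sum_range_succ, ← hpreimage,
      (measurePreserving_add_left volume (a + n * d)).setLIntegral_comp_preimage_emb
        (measurableEmbedding_addLeft _)]

theorem setLIntegral_Ico_eq_lintegral_sum {f : ℝ → ENNReal} (hf : Measurable f) (a : ℝ) {d : ℝ}
    (hd : 0 ≤ d) (n : ℕ) :
    ∫⁻ x in Set.Ico a (a + n * d), f x =
      ∫⁻ θ in Set.Ico 0 d, ∑ k ∈ Finset.range n, f (a + k * d + θ) := by
  rw [setLIntegral_Ico_eq_sum f a hd n, lintegral_finsetSum]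
  exact fun k _ => hf.comp (measurable_const_add _)

section Step

variable {w : ℕ} {B ρ : ℝ} {V : ℕ → ℝ} {A : Beam w}

theorem measurable_ofReal_card_occ_step (V : ℕ → ℝ) (r : Fin w → ℝ) :
    Measurable (Function.uncurry fun (A : Beam w) (s : ℝ) =>
      ENNReal.ofReal (V (A.step B s r).occ.card)) :=
  (measurable_from_nat (f := fun N => ENNReal.ofReal (V N))).comp
    (Beam.measurable_card_occ_step r)

/- The shifts `-B + k * (B / w) + θ` with `k < 2 * w` and `0 ≤ θ < B / w` fill `[-B, B)`, and for
fixed `θ` the average over `k` is the finite sum of `IsPotential.sum_newlyHit_le`. -/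
theorem IsPotential.setLIntegral_step_le (hV : IsPotential w ρ V) (hB : 0 < B)
    (hA : A.Consistent B) (hne : 1 ≤ A.occ.card) (r : Fin w → ℝ) :
    ∫⁻ s in Set.Icc (-B) B, ENNReal.ofReal (V (A.step B s r).occ.card) ≤
      ENNReal.ofReal (2 * B) * ENNReal.ofReal ((1 - ρ) * V A.occ.card) := by
  have hw : (0 : ℝ) < w := by
    exact_mod_cast hne.trans (by simpa only [Fintype.card_fin] using A.occ.card_le_univ)
  have hΔ : 0 < B / w := by positivity
  have hB2 : -B + ((2 * w : ℕ) : ℝ) * (B / w) = B := by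
    push_cast
    field_simp
    ring
  have hmeas : Measurable fun s => ENNReal.ofReal (V (A.step B s r).occ.card) :=
    (measurable_ofReal_card_occ_step V r).of_uncurry_left
  rw [setLIntegral_congr Ico_ae_eq_Icc.symm]
  calc ∫⁻ s in Set.Ico (-B) B, ENNReal.ofReal (V (A.step B s r).occ.card)
      = ∫⁻ θ in Set.Ico 0 (B / w), ∑ k ∈ Finset.range (2 * w),
          ENNReal.ofReal (V (A.step B (-B + k * (B / w) + θ) r).occ.card) := by
        rw [← setLIntegral_Ico_eq_lintegral_sum hmeas _ hΔ.le, hB2]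
    _ ≤ ∫⁻ _ in Set.Ico 0 (B / w), ENNReal.ofReal (2 * w * ((1 - ρ) * V A.occ.card)) := by
        refine setLIntegral_mono' measurableSet_Ico fun θ hθ => ?_
        obtain ⟨h0, h1⟩ := hθ
        have hcell := fun b hb => hA.shiftedCell_eq_or (b := b) hB h0 h1 hb
        simp only [hA.card_occ_step hB h0 h1]
        rw [← ENNReal.ofReal_sum_of_nonneg fun _ _ => hV.nonneg _]
        refine ENNReal.ofReal_le_ofReal (hV.sum_newlyHit_le hne ?_
          (card_le_two_mul_card_image hcell) Finset.card_image_le)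
        refine Finset.forall_mem_image.2 fun b hb => ?_
        have := hcell b hb
        omega
    _ = ENNReal.ofReal (2 * B) * ENNReal.ofReal ((1 - ρ) * V A.occ.card) := by
        rw [setLIntegral_const, Real.volume_Ico, sub_zero, ← ENNReal.ofReal_mul' hΔ.le,
          ← ENNReal.ofReal_mul (by positivity)]
        congr 1
        field_simp

theorem IsPotential.lintegral_step_le (hV : IsPotential w ρ V) (hB : 0 < B) (hA : A.Consistent B)
    (hne : 1 ≤ A.occ.card) (r : Fin w → ℝ) :
    ∫⁻ s, ENNReal.ofReal (V (A.step B s r).occ.card)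
        ∂(ProbabilityTheory.cond volume (Set.Icc (-B) B)) ≤
      ENNReal.ofReal (1 - ρ) * ENNReal.ofReal (V A.occ.card) := by
  have h2B : ENNReal.ofReal (2 * B) ≠ 0 := by simpa using hB
  rw [ProbabilityTheory.cond, lintegral_smul_measure, Real.volume_Icc, smul_eq_mul, sub_neg_eq_add,
    ← two_mul, ← ENNReal.ofReal_mul' (hV.nonneg _), ENNReal.inv_mul_le_iff h2B
      ENNReal.ofReal_ne_top]
  exact hV.setLIntegral_step_le hB hA hne r

end Step

section Expectation

variable {Ω : Type u} [MeasurableSpace Ω] {P : Measure Ω} {w : ℕ} {B ρ : ℝ} {s r : ℕ → Ω → ℝ}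
  {V : ℕ → ℝ}

/-- Every number is uniform on `[-B, B]` and independent of the numbers and the random numbers that
Phase A with `w` buckets uses before it. The random numbers may have any joint law, and they may
depend on the numbers read so far. -/
structure IsAdaptiveInput (P : Measure Ω) (w : ℕ) (B : ℝ) (s r : ℕ → Ω → ℝ) : Prop where
  measurable_s : ∀ j, Measurable (s j)
  measurable_r : ∀ k, Measurable (r k)
  uniform_s : ∀ j, pdf.IsUniform (s j) (Set.Icc (-B) B) P volume
  indep : ∀ j, IndepFun
    (fun ω => ((fun k : Fin j => s k ω), fun k : Fin (j * w) => r k ω)) (s j) P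

theorem IsPhaseAInput.isAdaptiveInput (h : IsPhaseAInput P B s r) (w : ℕ) :
    IsAdaptiveInput P w B s r where
  measurable_s := h.measurable_s
  measurable_r := h.measurable_r
  uniform_s := h.uniform_s
  indep j := by
    let S : Finset (ℕ ⊕ ℕ) := (Finset.range j).disjSum (Finset.range (j * w))
    let T : Finset (ℕ ⊕ ℕ) := {Sum.inl j}
    have hdisj : Disjoint S T := by simp [S, T]
    have hs (k : Fin j) : Sum.inl (k : ℕ) ∈ S := by simp [S]
    have hr (k : Fin (j * w)) : Sum.inr (k : ℕ) ∈ S := by simp [S]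
    have hhistory : Measurable fun t : S → ℝ =>
        ((fun k : Fin j => t ⟨_, hs k⟩), fun k : Fin (j * w) => t ⟨_, hr k⟩) := by fun_prop
    have hnext : Measurable fun t : T → ℝ => t ⟨_, Finset.mem_singleton_self _⟩ :=
      measurable_pi_apply _
    exact (h.indep.indepFun_finset S T hdisj
      (Sum.forall.2 ⟨h.measurable_s, h.measurable_r⟩)).comp hhistory hnext

theorem lintegral_comp_of_indepFun [IsFiniteMeasure P] {S T : Type*} [MeasurableSpace S]
    [MeasurableSpace T] {X : Ω → S} {Y : Ω → T} (hX : Measurable X) (hY : Measurable Y)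
    (hXY : IndepFun X Y P) {f : S → T → ENNReal} (hf : Measurable (Function.uncurry f)) :
    ∫⁻ ω, f (X ω) (Y ω) ∂P = ∫⁻ ω, ∫⁻ y, f (X ω) y ∂(P.map Y) ∂P := by
  calc ∫⁻ ω, f (X ω) (Y ω) ∂P = ∫⁻ p, Function.uncurry f p ∂(P.map fun ω => (X ω, Y ω)) :=
        (lintegral_map hf (hX.prodMk hY)).symm
    _ = ∫⁻ x, ∫⁻ y, f x y ∂(P.map Y) ∂(P.map X) := by
        rw [(indepFun_iff_map_prod_eq_prod_map_map hX.aemeasurable hY.aemeasurable).1 hXY,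
          lintegral_prod _ hf.aemeasurable]
        rfl
    _ = ∫⁻ ω, ∫⁻ y, f (X ω) y ∂(P.map Y) ∂P := lintegral_map hf.lintegral_prod_right' hX

namespace IsAdaptiveInput

theorem measurable_phaseA (h : IsAdaptiveInput P w B s r) (j : ℕ) :
    Measurable fun ω => phaseA w B (s · ω) (r · ω) j :=
  (_root_.measurable_phaseA j).comp
    ((measurable_pi_lambda _ h.measurable_s).prodMk (measurable_pi_lambda _ h.measurable_r))

theorem indepFun_phaseA (h : IsAdaptiveInput P w B s r) (j : ℕ) :
    IndepFun (fun ω => phaseA w B (s · ω) (r · ω) j) (s j) P := by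
  let extend (m : ℕ) (t : Fin m → ℝ) (k : ℕ) : ℝ := if hk : k < m then t ⟨k, hk⟩ else 0
  have hextend (m : ℕ) : Measurable (extend m) := by
    refine measurable_pi_lambda _ fun k => ?_
    by_cases hk : k < m <;> simp only [extend, hk, dite_true, dite_false] <;> fun_prop
  have hphase : Measurable fun p : (Fin j → ℝ) × (Fin (j * w) → ℝ) =>
      phaseA w B (extend j p.1) (extend (j * w) p.2) j :=
    (_root_.measurable_phaseA j).comp ((hextend j).prodMap (hextend (j * w)))
  have hcongr : (fun ω => phaseA w B (s · ω) (r · ω) j) = fun ω =>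
      phaseA w B (extend j fun k => s k ω) (extend (j * w) fun k => r k ω) j := by
    funext ω
    exact phaseA_congr (fun k hk => by simp [extend, hk]) fun k hk => by simp [extend, hk]
  rw [hcongr]
  exact (h.indep j).comp hphase measurable_id

end IsAdaptiveInput

namespace IsPotential

variable [IsProbabilityMeasure P]

theorem lintegral_phaseA_succ_le (hV : IsPotential w ρ V) (hB : 0 < B) (hw : 0 < w)
    (h : IsAdaptiveInput P w B s r) (j : ℕ) :
    ∫⁻ ω, ENNReal.ofReal (V (phaseA w B (s · ω) (r · ω) (j + 1)).occ.card) ∂P ≤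
      ENNReal.ofReal (1 - ρ) *
        ∫⁻ ω, ENNReal.ofReal (V (phaseA w B (s · ω) (r · ω) j).occ.card) ∂P := by
  have hocc : ∀ ω, (phaseA w B (s · ω) (r · ω) (j + 1)).occ =
      ((phaseA w B (s · ω) (r · ω) j).step B (s j ω) 0).occ := by
    intro ω
    ext i
    have hA := consistent_phaseA w B (s · ω) (r · ω) j
    rw [phaseA, hA.mem_occ_step hB, hA.mem_occ_step hB]
  simp only [hocc]
  rw [lintegral_comp_of_indepFun (f := fun A x => ENNReal.ofReal (V (A.step B x 0).occ.card))
    (h.measurable_phaseA j) (h.measurable_s j) (h.indepFun_phaseA j)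
    (measurable_ofReal_card_occ_step V 0),
    ← lintegral_const_mul' _ _ ENNReal.ofReal_ne_top]
  refine lintegral_mono fun ω => ?_
  rw [h.uniform_s j]
  exact hV.lintegral_step_le hB (consistent_phaseA _ _ _ _ _) (card_occ_phaseA_pos hB hw _ _ _) 0

theorem lintegral_phaseA_le (hV : IsPotential w ρ V) (hB : 0 < B) (hw : 0 < w)
    (h : IsAdaptiveInput P w B s r) (j : ℕ) :
    ∫⁻ ω, ENNReal.ofReal (V (phaseA w B (s · ω) (r · ω) j).occ.card) ∂P ≤
      ENNReal.ofReal ((1 - ρ) ^ j * V 1) := by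
  induction j with
  | zero => simp [card_occ_phaseA_zero hB hw]
  | succ j ih =>
    rw [pow_succ', mul_assoc, ENNReal.ofReal_mul (sub_nonneg.2 hV.rate_le_one)]
    exact (hV.lintegral_phaseA_succ_le hB hw h j).trans (by gcongr)

theorem prob_le (hV : IsPotential w ρ V) (hB : 0 < B) (hw : 0 < w)
    (h : IsAdaptiveInput P w B s r) (hpos : 0 < V (w - 1)) (j : ℕ) :
    P.real {ω | (phaseA w B (s · ω) (r · ω) j).anchors.ncard < w} ≤
      (1 - ρ) ^ j * (V 1 / V (w - 1)) := by
  have hmeas : Measurable fun ω =>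
      ENNReal.ofReal (V (phaseA w B (s · ω) (r · ω) j).occ.card) :=
    ENNReal.measurable_ofReal.comp (measurable_from_nat.comp
      (Beam.measurable_card_occ.comp (h.measurable_phaseA j)))
  have hsub : {ω | (phaseA w B (s · ω) (r · ω) j).anchors.ncard < w} ⊆
      {ω | ENNReal.ofReal (V (w - 1)) ≤
        ENNReal.ofReal (V (phaseA w B (s · ω) (r · ω) j).occ.card)} := by
    intro ω hω
    rw [Set.mem_ofPred_eq, (consistent_phaseA w B _ _ j).ncard_anchors hB] at hω
    exact ENNReal.ofReal_le_ofReal (hV.pred_le (card_occ_phaseA_pos hB hw _ _ j) hω)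
  have hmarkov := (measure_mono (μ := P) hsub).trans (meas_ge_le_lintegral_div hmeas.aemeasurable
    (ENNReal.ofReal_pos.2 hpos).ne' ENNReal.ofReal_ne_top)
  have hnonneg : 0 ≤ (1 - ρ) ^ j * V 1 :=
    mul_nonneg (pow_nonneg (sub_nonneg.2 hV.rate_le_one) _) (hV.nonneg 1)
  rw [← mul_div_assoc]
  refine ENNReal.toReal_le_of_le_ofReal (by positivity) (hmarkov.trans ?_)
  rw [ENNReal.ofReal_div_of_pos hpos]
  gcongr
  exact hV.lintegral_phaseA_le hB hw h j

end IsPotential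

end Expectation

/-! ### The two potentials -/

/-- The potential of rate `1 / 6` given by the number of empty buckets per occupied one. The
subtraction is truncated, so that the potential vanishes beyond `w`. -/
noncomputable def ratioPotential (w N : ℕ) : ℝ := ((w - N : ℕ) : ℝ) / N

theorem isPotential_ratioPotential (w : ℕ) : IsPotential w (1 / 6) (ratioPotential w) where
  rate_nonneg := by norm_num
  rate_le_one := by norm_num
  nonneg N := by unfold ratioPotential; positivity
  full := by simp [ratioPotential]
  decay N K F hN hNw hNK hKN hFK hNF := by
    have : (0 : ℝ) < N := by exact_mod_cast hN
    have hk : (0 : ℝ) < K := by exact_mod_cast (by omega : 0 < K)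
    have hempty : (0 : ℝ) < w - N := sub_pos.2 (by exact_mod_cast hNw)
    have h3K : (N : ℝ) + F ≤ 3 * K := by exact_mod_cast (by omega : N + F ≤ 3 * K)
    unfold ratioPotential
    push_cast [Nat.cast_sub hNF, Nat.cast_sub hNw.le]
    calc ((w : ℝ) - (N + F)) / (N + F) = (w - N) / N - w * F / N * (1 / (N + F)) := by
          field_simp
          ring
      _ ≤ (w - N) / N - w * F / N * (1 / (3 * K)) := by gcongr
      _ = (w - N) / N * (1 - 2 * w * (1 / 6) * F / (K * (w - N))) := by
          field_simp
          ring

theorem ratioPotential_one_div {w : ℕ} (hw : 2 ≤ w) :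
    ratioPotential w 1 / ratioPotential w (w - 1) = ((w : ℝ) - 1) ^ 2 := by
  rw [ratioPotential, ratioPotential, Nat.sub_sub_self (by omega), Nat.cast_sub (by omega)]
  simp [sq]

/-- The potential of rate `1 / 8`. The exponent is just below `-log 2 / log (3 / 2)`, so that
`(1 + f) ^ (-12 / 7) ≤ 1 - f` up to `f = 1 / 2`, and the ratio of the first value to the last
positive one is only `(w - 1) ^ (19 / 14)`. -/
noncomputable def sqrtPotential (w N : ℕ) : ℝ := √(((w : ℝ) - N) * (N : ℝ) ^ (-(12 / 7) : ℝ))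

theorem three_halves_rpow_le : (3 / 2 : ℝ) ^ (-(12 / 7) : ℝ) ≤ 1 / 2 := by
  rw [← pow_le_pow_iff_left₀ (by positivity) (by norm_num) (by norm_num : 7 ≠ 0),
    ← Real.rpow_mul_natCast (by norm_num),
    show (-(12 / 7) * (7 : ℕ) : ℝ) = ((-12 : ℤ) : ℝ) by norm_num, Real.rpow_intCast]
  norm_num

theorem one_add_rpow_le {f : ℝ} (h0 : 0 ≤ f) (h1 : f ≤ 1 / 2) :
    (1 + f) ^ (-(12 / 7) : ℝ) ≤ 1 - f := by
  have hbernoulli : (3 / 2 : ℝ) ^ (2 * f) ≤ 1 + f := by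
    have := rpow_one_add_le_one_add_mul_self (s := 1 / 2) (by norm_num)
      (p := 2 * f) (by linarith) (by linarith)
    norm_num at this ⊢
    linarith
  calc (1 + f) ^ (-(12 / 7) : ℝ) ≤ ((3 / 2 : ℝ) ^ (2 * f)) ^ (-(12 / 7) : ℝ) :=
        Real.rpow_le_rpow_of_nonpos (by positivity) hbernoulli (by norm_num)
    _ = ((3 / 2 : ℝ) ^ (-(12 / 7) : ℝ)) ^ (2 * f) := by
        rw [← Real.rpow_mul (by norm_num), ← Real.rpow_mul (by norm_num), mul_comm]
    _ ≤ (1 / 2 : ℝ) ^ (2 * f) :=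
        Real.rpow_le_rpow (by positivity) three_halves_rpow_le (by linarith)
    _ ≤ 1 - f := by
        have := rpow_one_add_le_one_add_mul_self (s := -(1 / 2)) (by norm_num)
          (p := 2 * f) (by linarith) (by linarith)
        norm_num at this ⊢
        linarith

theorem sqrt_mul_rpow_add_le {n W x : ℝ} (hn : 0 < n) (hW : n < W) (h0 : 0 ≤ x) (hx : x ≤ n / 2)
    (hxW : x ≤ W - n) :
    √((W - (n + x)) * (n + x) ^ (-(12 / 7) : ℝ)) ≤
      √((W - n) * n ^ (-(12 / 7) : ℝ)) * (1 - W * x / (2 * n * (W - n))) := by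
  have hu : 0 < W - n := sub_pos.2 hW
  obtain ⟨f, rfl⟩ : ∃ f, n * f = x := ⟨x / n, by field_simp⟩
  obtain ⟨g, hg⟩ : ∃ g, (W - n) * g = n * f := ⟨n * f / (W - n), by field_simp⟩
  have hf0 : 0 ≤ f := nonneg_of_mul_nonneg_right h0 hn
  have hf1 : f ≤ 1 / 2 := by nlinarith
  have : 0 ≤ g := nonneg_of_mul_nonneg_right (hg ▸ h0) hu
  have hg1 : g ≤ 1 := by nlinarith
  have hfg : (1 - g) * (1 + f) ^ (-(12 / 7) : ℝ) ≤ (1 - f / 2 - g / 2) ^ 2 := by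
    nlinarith [mul_le_mul_of_nonneg_left (one_add_rpow_le hf0 hf1) (sub_nonneg.2 hg1),
      sq_nonneg (f - g)]
  have hsplit : (W - (n + n * f)) * (n + n * f) ^ (-(12 / 7) : ℝ) =
      (W - n) * n ^ (-(12 / 7) : ℝ) * ((1 - g) * (1 + f) ^ (-(12 / 7) : ℝ)) := by
    rw [show n + n * f = n * (1 + f) by ring, Real.mul_rpow hn.le (by linarith)]
    linear_combination (n ^ (-(12 / 7) : ℝ) * (1 + f) ^ (-(12 / 7) : ℝ)) * hg
  have hrate : W * (n * f) / (2 * n * (W - n)) = f / 2 + g / 2 := by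
    rw [div_eq_iff (by positivity)]
    linear_combination (-n) * hg
  rw [hsplit, Real.sqrt_mul (by positivity), hrate, ← sub_sub]
  gcongr
  exact Real.sqrt_le_iff.2 ⟨by linarith, hfg⟩

theorem isPotential_sqrtPotential (w : ℕ) : IsPotential w (1 / 8) (sqrtPotential w) where
  rate_nonneg := by norm_num
  rate_le_one := by norm_num
  nonneg N := Real.sqrt_nonneg _
  full := by simp [sqrtPotential]
  decay N K F hN hNw hNK hKN hFK hNF := by
    have hn : (0 : ℝ) < N := by exact_mod_cast hN
    have hk : (0 : ℝ) < K := by exact_mod_cast (by omega : 0 < K)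
    have hw : (N : ℝ) < w := by exact_mod_cast hNw
    have : (0 : ℝ) < w - N := sub_pos.2 hw
    have hnf : (N : ℝ) + F ≤ w := by exact_mod_cast hNF
    have hnk : (N : ℝ) ≤ 2 * K := by exact_mod_cast hNK
    have hfk : (F : ℝ) / K ≤ 1 := (div_le_one hk).2 (by exact_mod_cast hFK)
    unfold sqrtPotential
    push_cast
    -- Only the first `N / 2` newly filled buckets are counted.
    set x : ℝ := min F (N / 2) with hx
    have hx0 : 0 ≤ x := by positivity
    have hxF : x ≤ F := min_le_left _ _
    have hxN : x ≤ N / 2 := min_le_right _ _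
    have hFx : N * F ≤ 2 * K * x := by
      rcases min_choice (F : ℝ) (N / 2) with h | h <;> rw [hx, h]
      · gcongr
      · rw [div_le_one hk] at hfk
        nlinarith
    calc √(((w : ℝ) - (N + F)) * ((N : ℝ) + F) ^ (-(12 / 7) : ℝ))
        ≤ √(((w : ℝ) - (N + x)) * ((N : ℝ) + x) ^ (-(12 / 7) : ℝ)) := by
          have hpow : ((N : ℝ) + F) ^ (-(12 / 7) : ℝ) ≤ ((N : ℝ) + x) ^ (-(12 / 7) : ℝ) :=
            Real.rpow_le_rpow_of_nonpos (by positivity) (by gcongr) (by norm_num)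
          gcongr
          linarith
      _ ≤ √(((w : ℝ) - N) * (N : ℝ) ^ (-(12 / 7) : ℝ)) * (1 - w * x / (2 * N * (w - N))) :=
          sqrt_mul_rpow_add_le hn hw hx0 hxN (by linarith)
      _ ≤ √(((w : ℝ) - N) * (N : ℝ) ^ (-(12 / 7) : ℝ)) *
          (1 - 2 * w * (1 / 8) * F / (K * (w - N))) := by
          refine mul_le_mul_of_nonneg_left (sub_le_sub_left ?_ 1) (Real.sqrt_nonneg _)
          rw [div_le_div_iff₀ (by positivity) (by positivity)]
          nlinarith [mul_le_mul_of_nonneg_left hFx (by positivity : 0 ≤ w * ((w : ℝ) - N))]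

theorem sqrtPotential_pos {w N : ℕ} (hN : 1 ≤ N) (hNw : N < w) : 0 < sqrtPotential w N := by
  have hempty : (0 : ℝ) < w - N := sub_pos.2 (by exact_mod_cast hNw)
  exact Real.sqrt_pos.2 (by positivity)

theorem sqrtPotential_pow_fourteen {w N : ℕ} (hNw : N ≤ w) :
    sqrtPotential w N ^ 14 = ((w : ℝ) - N) ^ 7 / N ^ 12 := by
  have hempty : (0 : ℝ) ≤ w - N := sub_nonneg.2 (by exact_mod_cast hNw)
  rw [sqrtPotential, show 14 = 2 * 7 from rfl, pow_mul, Real.sq_sqrt (by positivity), mul_pow,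
    ← Real.rpow_mul_natCast (by positivity),
    show (-(12 / 7) * (7 : ℕ) : ℝ) = ((-12 : ℤ) : ℝ) by norm_num, Real.rpow_intCast]
  rfl

theorem sqrtPotential_one_div {w : ℕ} (hw : 2 ≤ w) :
    sqrtPotential w 1 / sqrtPotential w (w - 1) = ((w : ℝ) - 1) ^ (19 / 14 : ℝ) := by
  have hx : (0 : ℝ) < w - 1 := sub_pos.2 (by exact_mod_cast hw)
  have hV := (isPotential_sqrtPotential w).nonneg
  refine (pow_left_inj₀ (div_nonneg (hV 1) (hV (w - 1))) (by positivity)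
    (by norm_num : 14 ≠ 0)).1 ?_
  rw [div_pow, sqrtPotential_pow_fourteen (by omega), sqrtPotential_pow_fourteen (by omega),
    ← Real.rpow_mul_natCast hx.le, show (19 / 14 * (14 : ℕ) : ℝ) = ((19 : ℕ) : ℝ) by norm_num,
    Real.rpow_natCast, Nat.cast_sub (by omega)]
  push_cast
  field_simp
  ring

theorem IsPotential.update_one {w : ℕ} {ρ v : ℝ} {V : ℕ → ℝ} (hV : IsPotential w ρ V)
    (hw : w ≠ 1) (hv : 0 ≤ v) (hle : V 2 ≤ v * (1 - 2 * w * ρ / (w - 1))) :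
    IsPotential w ρ (Function.update V 1 v) where
  rate_nonneg := hV.rate_nonneg
  rate_le_one := hV.rate_le_one
  nonneg N := by
    rcases eq_or_ne N 1 with rfl | h
    · rwa [Function.update_self]
    · simpa only [Function.update_of_ne h] using hV.nonneg N
  full := by rw [Function.update_of_ne hw, hV.full]
  decay N K F hN hNw hNK hKN hFK hNF := by
    rcases Nat.eq_zero_or_pos F with rfl | hF
    · simp
    rcases eq_or_ne N 1 with rfl | h
    · obtain rfl : K = 1 := by omega
      obtain rfl : F = 1 := by omega
      simpa using hle
    · rw [Function.update_of_ne h, Function.update_of_ne (by omega)]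
      exact hV.decay N K F hN hNw hNK hKN hFK hNF

/-! ### Iteration counts -/

theorem le_log_eight_sevenths : (2 * (1 / 15 + (1 / 15) ^ 3 / 3) : ℝ) ≤ Real.log (8 / 7) := by
  have hseries := Real.hasSum_log_sub_log_of_abs_lt_one (x := 1 / 15) (by norm_num [abs_of_pos])
  have hpartial := sum_le_hasSum (Finset.range 2) (fun k _ => by positivity) hseries
  rw [← Real.log_div (by norm_num) (by norm_num)] at hpartial
  norm_num [Finset.sum_range_succ] at hpartial ⊢
  exact hpartial

theorem le_jHalf {w k : ℕ} (hw : 2 ≤ w) (h : (2719 / 1000 : ℝ) ^ k ≤ ((w : ℝ) - 1) ^ 4) :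
    k ≤ jHalf w := by
  have hx : (0 : ℝ) < w - 1 := sub_pos.2 (by exact_mod_cast hw)
  have hexp : Real.exp k ≤ ((w : ℝ) - 1) ^ 4 := by
    calc Real.exp k = Real.exp 1 ^ k := by rw [← Real.exp_nat_mul, mul_one]
      _ ≤ (2719 / 1000) ^ k := by
        gcongr
        linarith [Real.exp_one_lt_d9]
      _ ≤ ((w : ℝ) - 1) ^ 4 := h
  have hlog := (Real.le_log_iff_exp_le (by positivity)).2 hexp
  exact Nat.le_floor (by simpa only [Real.log_pow, Nat.cast_ofNat] using hlog)

theorem rpow_le_pow_jHalf {w : ℕ} (hw : 2 ≤ w) :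
    7 / 8 * ((w : ℝ) - 1) ^ (37 / 70 : ℝ) ≤ (8 / 7) ^ jHalf w := by
  have hx : (1 : ℝ) ≤ w - 1 := le_sub_iff_add_le.2 (by exact_mod_cast hw)
  have hfloor : 4 * Real.log ((w : ℝ) - 1) - 1 ≤ jHalf w := (Nat.sub_one_lt_floor _).le
  have hrate : 37 / 70 ≤ 4 * Real.log (8 / 7) := by
    have := le_log_eight_sevenths
    norm_num at this
    linarith
  calc 7 / 8 * ((w : ℝ) - 1) ^ (37 / 70 : ℝ)
      ≤ 7 / 8 * ((w : ℝ) - 1) ^ (4 * Real.log (8 / 7)) := by gcongr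
    _ = (8 / 7 : ℝ) ^ (4 * Real.log ((w : ℝ) - 1) - 1) := by
        rw [Real.rpow_sub_one (by norm_num), Real.rpow_def_of_pos (by linarith),
          Real.rpow_def_of_pos (by norm_num)]
        ring_nf
    _ ≤ (8 / 7 : ℝ) ^ (jHalf w : ℝ) := by
        gcongr
        norm_num
    _ = (8 / 7) ^ jHalf w := Real.rpow_natCast _ _

theorem sqrtPotential_one_div_le {w : ℕ} (hw : 129 ≤ w) :
    sqrtPotential w 1 / sqrtPotential w (w - 1) ≤ w / 2 * (8 / 7) ^ jHalf w := by
  have hjHalf := rpow_le_pow_jHalf (by omega : 2 ≤ w)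
  rw [sqrtPotential_one_div (by omega)]
  have h128 : (128 : ℝ) ≤ w - 1 := le_sub_iff_add_le.2 (by norm_num; exact_mod_cast hw)
  set x : ℝ := w - 1
  have hx : 0 < x := by linarith
  have h16 : (16 / 7 : ℝ) ≤ x ^ (6 / 35 : ℝ) := by
    rw [← pow_le_pow_iff_left₀ (by norm_num) (by positivity) (by norm_num : 35 ≠ 0),
      ← Real.rpow_mul_natCast hx.le, show (6 / 35 * (35 : ℕ) : ℝ) = ((6 : ℕ) : ℝ) by norm_num,
      Real.rpow_natCast]
    exact le_trans (by norm_num) (pow_le_pow_left₀ (by norm_num) h128 6)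
  calc x ^ (19 / 14 : ℝ) = x * x ^ (5 / 14 : ℝ) := by
        rw [← Real.rpow_one_add' hx.le (by norm_num)]
        norm_num
    _ = x / 2 * (7 / 8 * (x ^ (5 / 14 : ℝ) * (16 / 7))) := by ring
    _ ≤ w / 2 * (7 / 8 * (x ^ (5 / 14 : ℝ) * x ^ (6 / 35 : ℝ))) := by
        gcongr
        linarith
    _ = w / 2 * (7 / 8 * x ^ (37 / 70 : ℝ)) := by
        rw [← Real.rpow_add hx]
        norm_num
    _ ≤ w / 2 * (8 / 7) ^ jHalf w := by gcongr

theorem exists_pow_le_and_potential_le : ∀ w : ℕ, w < 129 → 3 ≤ w → ∃ k ≤ 20,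
    (2719 / 1000 : ℚ) ^ k ≤ (w - 1) ^ 4 ∧
      ((w : ℚ) - 2) ^ 7 / 2 ^ 12 * (w - 1) ^ 12 * (4 * (w - 1) / (3 * w - 4)) ^ 14 ≤
        (w / 2 * (8 / 7) ^ k) ^ 14 := by
  decide +kernel

theorem sqrtPotential_two_div_mul_le {w : ℕ} (h3 : 3 ≤ w) (h129 : w < 129) :
    sqrtPotential w 2 * (4 * (w - 1) / (3 * w - 4)) / sqrtPotential w (w - 1) ≤
      w / 2 * (8 / 7) ^ jHalf w := by
  obtain ⟨k, -, hk, hle⟩ := exists_pow_le_and_potential_le w h129 h3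
  replace hk := (Rat.cast_le (K := ℝ)).2 hk
  replace hle := (Rat.cast_le (K := ℝ)).2 hle
  push_cast at hk hle
  have hkJ : k ≤ jHalf w := le_jHalf (by omega) hk
  have hw : (3 : ℝ) ≤ w := by exact_mod_cast h3
  refine le_trans ((pow_le_pow_iff_left₀ ?_ (by positivity) (by norm_num : 14 ≠ 0)).1 ?_)
    (mul_le_mul_of_nonneg_left (pow_le_pow_right₀ (by norm_num) hkJ) (by positivity))
  · have hV := (isPotential_sqrtPotential w).nonneg
    exact div_nonneg (mul_nonneg (hV 2) (div_nonneg (by linarith) (by linarith))) (hV (w - 1))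
  · refine le_of_eq_of_le ?_ hle
    rw [div_pow (_ * _), mul_pow (sqrtPotential w 2), sqrtPotential_pow_fourteen (by omega),
      sqrtPotential_pow_fourteen (by omega), Nat.cast_sub (by omega)]
    push_cast
    rw [sub_sub_cancel, one_pow]
    field_simp

/- For `w < 129` the ratio of the square root potential is too large by a constant factor, and its
value at `1` is lowered as far as the decay from `1` to `2` permits. -/
theorem exists_isPotential_one_div_le {w : ℕ} (hw : 2 ≤ w) :
    ∃ V : ℕ → ℝ, IsPotential w (1 / 8) V ∧ 0 < V (w - 1) ∧
      V 1 / V (w - 1) ≤ w / 2 * (8 / 7) ^ jHalf w := by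
  have hV := isPotential_sqrtPotential w
  have hpos : 0 < sqrtPotential w (w - 1) := sqrtPotential_pos (by omega) (by omega)
  rcases lt_or_ge w 129 with h129 | h129
  · rcases hw.lt_or_eq with h3 | rfl
    · have hw3 : (3 : ℝ) ≤ w := by exact_mod_cast h3
      have hx : (w : ℝ) - 1 ≠ 0 := by linarith
      have hy : 3 * (w : ℝ) - 4 ≠ 0 := by linarith
      have hrate : 1 - 2 * w * (1 / 8) / (w - 1) = (3 * (w : ℝ) - 4) / (4 * (w - 1)) := by
        field_simp
        ring
      have hlast : w - 1 ≠ 1 := by omega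
      refine ⟨_, hV.update_one (v := sqrtPotential w 2 * (4 * (w - 1) / (3 * w - 4))) (by omega)
        (mul_nonneg (hV.nonneg 2) (div_nonneg (by linarith) (by linarith))) (le_of_eq ?_), ?_⟩
      · rw [hrate, mul_assoc, div_mul_div_cancel₀ hy, div_self (by simpa using hx), mul_one]
      · rw [Function.update_self, Function.update_of_ne hlast]
        exact ⟨hpos, sqrtPotential_two_div_mul_le h3 h129⟩
    · exact ⟨_, hV, hpos, by rw [sqrtPotential_one_div hw]; norm_num [jHalf]⟩
  · exact ⟨_, hV, hpos, sqrtPotential_one_div_le h129⟩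

theorem one_sub_pow_tDelta_le {w : ℕ} (hw : 0 < w) {δ : ℝ} (h0 : 0 < δ) :
    (7 / 8 : ℝ) ^ tDelta w δ ≤ 2 * δ / w := by
  have hceil : Real.log (w / (2 * δ)) ≤ tDelta w δ * Real.log (8 / 7) :=
    (div_le_iff₀ (Real.log_pos (by norm_num))).1 (Nat.le_ceil _)
  have hpow : (w : ℝ) / (2 * δ) ≤ (8 / 7) ^ tDelta w δ := by
    rwa [← Real.log_pow, Real.log_le_log_iff (by positivity) (by positivity)] at hceil
  calc (7 / 8 : ℝ) ^ tDelta w δ = ((8 / 7) ^ tDelta w δ)⁻¹ := by rw [← inv_pow, inv_div]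
    _ ≤ (w / (2 * δ))⁻¹ := by gcongr
    _ = 2 * δ / w := inv_div _ _

theorem jDelta_le {w : ℕ} (hw : 2 ≤ w) {δ : ℝ} (h0 : 0 < δ) (h1 : δ < 1) :
    (jDelta w δ : ℝ) ≤ 4 * Real.log w + Real.log (w / (2 * δ)) / Real.log (8 / 7) + 1 := by
  have hw2 : (2 : ℝ) ≤ w := by exact_mod_cast hw
  have hjHalf : (jHalf w : ℝ) ≤ 4 * Real.log w := by
    calc (jHalf w : ℝ) ≤ 4 * Real.log ((w : ℝ) - 1) :=
          Nat.floor_le (mul_nonneg (by norm_num) (Real.log_nonneg (by linarith)))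
      _ ≤ 4 * Real.log w := by
          gcongr
          · linarith
          · linarith
  have htDelta : (tDelta w δ : ℝ) < Real.log (w / (2 * δ)) / Real.log (8 / 7) + 1 :=
    Nat.ceil_lt_add_one (div_nonneg
      (Real.log_nonneg ((one_le_div (by positivity)).2 (by linarith)))
      (Real.log_nonneg (by norm_num)))
  rw [jDelta]
  push_cast
  linarith

theorem four_mul_log_add_log_div_le {w : ℕ} (hw : 0 < w) {δ : ℝ} (h0 : 0 < δ) :
    4 * Real.log w + Real.log (w / (2 * δ)) / Real.log (8 / 7) + 1 ≤
      (4 + 1 / Real.log (8 / 7)) * Real.log w + Real.log (1 / δ) / Real.log (8 / 7) + 1 := by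
  have : 0 ≤ Real.log (8 / 7) := Real.log_nonneg (by norm_num)
  calc 4 * Real.log w + Real.log (w / (2 * δ)) / Real.log (8 / 7) + 1
      ≤ 4 * Real.log w + Real.log (w * (1 / δ)) / Real.log (8 / 7) + 1 := by
        rw [mul_one_div]
        gcongr
        linarith
    _ = (4 + 1 / Real.log (8 / 7)) * Real.log w + Real.log (1 / δ) / Real.log (8 / 7) + 1 := by
        rw [Real.log_mul (by positivity) (by positivity)]
        ring

theorem four_add_one_div_mul_log_le {w : ℕ} {δ : ℝ} (h0 : 0 < δ) (h1 : δ < 1) :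
    (4 + 1 / Real.log (8 / 7)) * Real.log w + Real.log (1 / δ) / Real.log (8 / 7) + 1 ≤
      11.489 * Real.log w + 7.489 * Real.log (1 / δ) + 1 := by
  have hlog := le_log_eight_sevenths
  have hinv : 1 / Real.log (8 / 7) ≤ 7.489 := by
    rw [div_le_iff₀ (Real.log_pos (by norm_num))]
    norm_num at hlog ⊢
    linarith
  have hlogδ : 0 ≤ Real.log (1 / δ) := Real.log_nonneg ((one_le_div h0).2 h1.le)
  have hw := mul_le_mul_of_nonneg_right hinv (Real.log_natCast_nonneg w)
  have hδ := mul_le_mul_of_nonneg_right hinv hlogδ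
  rw [div_eq_mul_one_div (Real.log (1 / δ))]
  linarith

theorem log_le_logb_two {x : ℝ} (hx : 1 ≤ x) : Real.log x ≤ Real.logb 2 x := by
  rw [Real.logb, le_div_iff₀ (Real.log_pos (by norm_num))]
  exact mul_le_of_le_one_right (Real.log_nonneg hx) (by linarith [Real.log_two_lt_d9])

theorem jDelta_le_logb {w : ℕ} (hw : 2 ≤ w) {δ : ℝ} (h0 : 0 < δ) (h1 : δ < 1) :
    (jDelta w δ : ℝ) ≤ 12 * Real.logb 2 w + 12 * Real.logb 2 (1 / δ) + 1 := by
  have hw1 : (1 : ℝ) ≤ w := by exact_mod_cast (by omega : 1 ≤ w)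
  have hδ : 1 ≤ 1 / δ := (one_le_div h0).2 h1.le
  have hbound := (jDelta_le hw h0 h1).trans ((four_mul_log_add_log_div_le (by omega) h0).trans
    (four_add_one_div_mul_log_le h0 h1))
  linarith [log_le_logb_two hw1, log_le_logb_two hδ, Real.log_nonneg hw1, Real.log_nonneg hδ]

theorem two_rpow_le_six_fifths_rpow {x : ℝ} (hx : 0 ≤ x) :
    (2 : ℝ) ^ (6 / 23 * x) ≤ (6 / 5) ^ x := by
  rw [Real.rpow_mul (by norm_num)]
  refine Real.rpow_le_rpow (by positivity) ?_ hx
  rw [← pow_le_pow_iff_left₀ (by positivity) (by norm_num) (by norm_num : 23 ≠ 0),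
    ← Real.rpow_mul_natCast (by norm_num),
    show (6 / 23 * (23 : ℕ) : ℝ) = (6 : ℕ) by norm_num, Real.rpow_natCast]
  norm_num

theorem sq_mul_one_div_le_six_fifths_pow {w j : ℕ} (hw : 0 < w) {δ : ℝ} (h0 : 0 < δ)
    (hj : 23 / 6 * (2 * Real.logb 2 w + Real.logb 2 (1 / δ)) ≤ j) :
    (w : ℝ) ^ 2 * (1 / δ) ≤ (6 / 5) ^ j := by
  calc (w : ℝ) ^ 2 * (1 / δ)
      = 2 ^ (2 * Real.logb 2 w + Real.logb 2 (1 / δ)) := by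
        rw [Real.rpow_add (by norm_num), mul_comm 2, Real.rpow_mul (by norm_num),
          Real.rpow_logb (by norm_num) (by norm_num) (by positivity),
          Real.rpow_logb (by norm_num) (by norm_num) (by positivity)]
        norm_num
    _ ≤ 2 ^ (6 / 23 * (j : ℝ)) :=
        Real.rpow_le_rpow_of_exponent_le (by norm_num) (by linarith)
    _ ≤ (6 / 5) ^ (j : ℝ) := two_rpow_le_six_fifths_rpow (Nat.cast_nonneg j)
    _ = (6 / 5) ^ j := Real.rpow_natCast _ _

/-! ### The failure probability -/

section Probability

variable {Ω : Type u} [MeasurableSpace Ω] {P : Measure Ω} [IsProbabilityMeasure P] {w : ℕ}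
  {B δ : ℝ} {s r : ℕ → Ω → ℝ}

namespace IsAdaptiveInput

theorem prob_le_of_jDelta_le (h : IsAdaptiveInput P w B s r) (hB : 0 < B) (hw : 2 ≤ w)
    (h0 : 0 < δ) {j : ℕ} (hj : jDelta w δ ≤ j) :
    P.real {ω | (phaseA w B (s · ω) (r · ω) j).anchors.ncard < w} ≤ δ := by
  obtain ⟨V, hV, hpos, hratio⟩ := exists_isPotential_one_div_le hw
  have : (0 : ℝ) < w := by exact_mod_cast (by omega : 0 < w)
  have hpow : (1 - 1 / 8 : ℝ) ^ j ≤ (7 / 8) ^ jHalf w * (2 * δ / w) := by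
    calc (1 - 1 / 8 : ℝ) ^ j = (7 / 8) ^ j := by norm_num
      _ ≤ (7 / 8) ^ jDelta w δ := pow_le_pow_of_le_one (by norm_num) (by norm_num) hj
      _ = (7 / 8) ^ jHalf w * (7 / 8) ^ tDelta w δ := by rw [jDelta, pow_add]
      _ ≤ (7 / 8) ^ jHalf w * (2 * δ / w) := by
        gcongr
        exact one_sub_pow_tDelta_le (by omega) h0
  have hratio0 : 0 ≤ V 1 / V (w - 1) := div_nonneg (hV.nonneg 1) hpos.le
  calc P.real {ω | (phaseA w B (s · ω) (r · ω) j).anchors.ncard < w}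
      ≤ (1 - 1 / 8) ^ j * (V 1 / V (w - 1)) := hV.prob_le hB (by omega) h hpos j
    _ ≤ (7 / 8) ^ jHalf w * (2 * δ / w) * (w / 2 * (8 / 7) ^ jHalf w) := by gcongr
    _ = (7 / 8 * (8 / 7)) ^ jHalf w * δ := by
        rw [mul_pow]
        field_simp
    _ = δ := by norm_num

theorem prob_le_of_logb_le (h : IsAdaptiveInput P w B s r) (hB : 0 < B) (hw : 2 ≤ w)
    (h0 : 0 < δ) {j : ℕ} (hj : 23 / 6 * (2 * Real.logb 2 w + Real.logb 2 (1 / δ)) ≤ j) :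
    P.real {ω | (phaseA w B (s · ω) (r · ω) j).anchors.ncard < w} ≤ δ := by
  have hpos : 0 < ratioPotential w (w - 1) :=
    div_pos (by exact_mod_cast (by omega : 0 < w - (w - 1)))
      (by exact_mod_cast (by omega : 0 < w - 1))
  have hw2 : (2 : ℝ) ≤ w := by exact_mod_cast hw
  have hpow := sq_mul_one_div_le_six_fifths_pow (by omega) h0 hj
  calc P.real {ω | (phaseA w B (s · ω) (r · ω) j).anchors.ncard < w}
      ≤ (1 - 1 / 6) ^ j * (ratioPotential w 1 / ratioPotential w (w - 1)) :=
        (isPotential_ratioPotential w).prob_le hB (by omega) h hpos j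
    _ = ((6 / 5) ^ j)⁻¹ * ((w : ℝ) - 1) ^ 2 := by
        rw [ratioPotential_one_div hw, ← inv_pow]
        norm_num
    _ ≤ (w ^ 2 * (1 / δ))⁻¹ * w ^ 2 := by
        gcongr
        · linarith
        · linarith
    _ = δ := by field_simp

theorem exists_prob_le (h : IsAdaptiveInput P w B s r) (hB : 0 < B) (hw : 2 ≤ w)
    (h0 : 0 < δ) (h1 : δ < 1) :
    ∃ j : ℕ, (j : ℝ) ≤ 7.96 * Real.logb 2 w + 5.19 * Real.logb 2 (1 / δ) + 1 ∧
      P.real {ω | (phaseA w B (s · ω) (r · ω) j).anchors.ncard < w} ≤ δ := by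
  have hL : 0 ≤ Real.logb 2 w :=
    Real.logb_nonneg (by norm_num) (by exact_mod_cast (by omega : 1 ≤ w))
  have hM : 0 ≤ Real.logb 2 (1 / δ) := Real.logb_nonneg (by norm_num) ((one_le_div h0).2 h1.le)
  refine ⟨⌈23 / 6 * (2 * Real.logb 2 w + Real.logb 2 (1 / δ))⌉₊, ?_,
    h.prob_le_of_logb_le hB hw h0 (Nat.le_ceil _)⟩
  exact (Nat.ceil_lt_add_one (by positivity)).le.trans (by linarith)

end IsAdaptiveInput

end Probability

/-! ### Candidate lists -/

theorem filterMap_eq_toList {ι β : Type*} {f : ι → Option β} {i : ι} {l : List ι}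
    (hl : l.Nodup) (hi : i ∈ l) (hf : ∀ b ≠ i, f b = none) : l.filterMap f = (f i).toList := by
  obtain ⟨l₁, l₂, rfl⟩ := List.append_of_mem hi
  have hnil : ∀ l' : List ι, i ∉ l' → l'.filterMap f = [] := fun l' hi' =>
    List.filterMap_eq_nil_iff.2 fun b hb => hf b (ne_of_mem_of_not_mem hb hi')
  obtain ⟨hi₂, -⟩ := List.nodup_cons.1 hl.of_append_right
  have hi₁ : i ∉ l₁ := fun h => List.disjoint_of_nodup_append hl h List.mem_cons_self
  rw [List.filterMap_append, hnil l₁ hi₁, List.nil_append]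
  cases hfi : f i <;> simp [hfi, hnil l₂ hi₂]

theorem length_filterMap_le_card {ι β : Type*} {f : ι → Option β} {l : List ι}
    (hl : l.Nodup) {T : Finset ι} (h : ∀ b, (f b).isSome → b ∈ T) :
    (l.filterMap f).length ≤ T.card := by
  classical
  rw [List.length_filterMap_eq_countP, List.countP_eq_length_filter,
    ← List.toFinset_card_of_nodup (hl.filter _)]
  exact Finset.card_le_card fun b hb => h b (List.mem_filter.1 (List.mem_toFinset.1 hb)).2

namespace Beam

variable {w : ℕ} {B : ℝ} {A : Beam w}

open scoped Classical in
/-- The candidates for bucket `i` at the moment when the elements kept in the first `k` buckets have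
been shifted by `s`; an element that was kept in bucket `i` comes first. -/
noncomputable def partialCandidates (B : ℝ) (A : Beam w) (s : ℝ) (k : ℕ) (i : Fin w) : List ℝ :=
  (A i).toList ++
    ((List.finRange w).take k).filterMap fun b => ((A b).map (· + s)).filter (· ∈ bucket w B i)

theorem partialCandidates_zero (A : Beam w) (s : ℝ) (i : Fin w) :
    A.partialCandidates B s 0 i = (A i).toList := by
  simp [partialCandidates]

theorem partialCandidates_succ_of_eq_none {s : ℝ} {k : Fin w} (hk : A k = none) (i : Fin w) :
    A.partialCandidates B s (k + 1) i = A.partialCandidates B s k i := by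
  rw [partialCandidates, List.take_add_one, List.filterMap_append, ← List.append_assoc,
    ← partialCandidates]
  simp [hk]

open scoped Classical in
theorem partialCandidates_succ_of_eq_some {s a : ℝ} {k : Fin w} (hk : A k = some a) (i : Fin w) :
    A.partialCandidates B s (k + 1) i =
      if a + s ∈ bucket w B i then A.partialCandidates B s k i ++ [a + s]
      else A.partialCandidates B s k i := by
  rw [partialCandidates, List.take_add_one, List.filterMap_append, ← List.append_assoc,
    ← partialCandidates]
  split_ifs with h <;> simp [hk, Option.filter_some, h]

namespace Consistent

theorem partialCandidates_eq_candidates (hA : A.Consistent B) (hB : 0 < B) (s : ℝ) (i : Fin w) :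
    A.partialCandidates B s w i = A.candidates B s i := by
  classical
  rw [candidates_eq_append, partialCandidates, List.take_of_length_le (by simp)]
  congr 1
  rw [filterMap_eq_toList (i := i) (List.nodup_finRange w) (List.mem_finRange i)]
  · cases h : A i with
    | none => rfl
    | some a => simp [Option.filter_some, hA i a h]
  · intro b hb
    cases h : A b with
    | none => rfl
    | some a =>
      have ha : a ∉ bucket w B i := fun ha => hb (hA.eq_of_mem_bucket hB h ha)
      simp [Option.filter_some, ha]

open scoped Classical in
theorem card_filter_add_mem_bucket_le_two (hA : A.Consistent B) (hB : 0 < B) (s : ℝ)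
    (i : Fin w) :
    (Finset.univ.filter fun b => ∃ a, A b = some a ∧ a + s ∈ bucket w B i).card ≤ 2 := by
  set T := Finset.univ.filter fun b => ∃ a, A b = some a ∧ a + s ∈ bucket w B i
  set p := -B / 2 + i * (B / w) - s with hp
  have hcell : ∀ b ∈ T, (cell w B p + 1).toNat = b ∨ (cell w B p + 1).toNat = b + 1 := by
    intro b hb
    obtain ⟨a, ha, h0, h1⟩ := (Finset.mem_filter.1 hb).2
    have hab := (mem_bucket_iff_cell_eq hB b a).1 (hA b a ha)
    have := _root_.cell_add_eq_or (x := p) (θ := a - p) hB i.pos (by linarith) (by linarith)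
    rw [add_sub_cancel, hab] at this
    omega
  have himage : (T.image fun _ => (cell w B p + 1).toNat).card ≤ 1 :=
    Finset.card_le_one.2 fun x hx y hy => by
      obtain ⟨_, _, rfl⟩ := Finset.mem_image.1 hx
      obtain ⟨_, _, rfl⟩ := Finset.mem_image.1 hy
      rfl
  have := card_le_two_mul_card_image hcell
  omega

theorem length_partialCandidates_le (hA : A.Consistent B) (hB : 0 < B) (s : ℝ) (k : ℕ)
    (i : Fin w) : (A.partialCandidates B s k i).length ≤ 3 := by
  classical
  have hold : (A i).toList.length ≤ 1 := by cases A i <;> simp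
  have hshifted : (((List.finRange w).take k).filterMap fun b =>
      ((A b).map (· + s)).filter (· ∈ bucket w B i)).length ≤ 2 := by
    refine (length_filterMap_le_card ((List.nodup_finRange w).sublist (List.take_sublist _ _))
      fun b hb => ?_).trans (hA.card_filter_add_mem_bucket_le_two hB s i)
    obtain ⟨x, hx⟩ := Option.isSome_iff_exists.1 hb
    obtain ⟨hx, hmem⟩ := Option.filter_eq_some_iff.1 hx
    obtain ⟨a, ha, rfl⟩ := Option.map_eq_some_iff.1 hx
    exact Finset.mem_filter.2 ⟨Finset.mem_univ b, a, ha, of_decide_eq_true hmem⟩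
  rw [partialCandidates, List.length_append]
  omega

theorem length_partialCandidates_le_two (hA : A.Consistent B) (hB : 0 < B) {s a : ℝ} {k i : Fin w}
    (hk : A k = some a) (hi : a + s ∈ bucket w B i) :
    (A.partialCandidates B s k i).length ≤ 2 := by
  have := hA.length_partialCandidates_le hB s (k + 1) i
  rw [partialCandidates_succ_of_eq_some hk, if_pos hi, List.length_append,
    List.length_singleton] at this
  omega

end Consistent

end Beam

/-! ### Running time -/

namespace Prog

/-- The result of a program and the machine after its execution. -/
def exec {α : Type} (p : Prog α) (m : RAM) : α × RAM := (StateT.run p m : Id (α × RAM))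

/-- The program takes at most `t` units of time, whatever the state in which it is started. -/
def TimeLE {α : Type} (p : Prog α) (t : ℕ) : Prop := ∀ m, (exec p m).2.time ≤ m.time + t

namespace TimeLE

variable {α β : Type}

theorem mono {p : Prog α} {t t' : ℕ} (hp : TimeLE p t) (h : t ≤ t') : TimeLE p t' :=
  fun m => (hp m).trans (by omega)

theorem pure (a : α) : TimeLE (Pure.pure a) 0 := fun _ => le_rfl

theorem op (a : α) : TimeLE (Prog.op a) 1 := fun _ => le_rfl

theorem load (a : ℕ) : TimeLE (Prog.load a) 1 := fun _ => le_rfl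

theorem store (a : ℕ) (x : ℝ) : TimeLE (Prog.store a x) 1 := fun _ => le_rfl

theorem readItem : TimeLE Prog.readItem 1 := fun _ => le_rfl

theorem readCoin : TimeLE Prog.readCoin 1 := fun _ => le_rfl

theorem bind {p : Prog α} {f : α → Prog β} {t t' : ℕ} (hp : TimeLE p t)
    (hf : ∀ a, TimeLE (f a) t') : TimeLE (p >>= f) (t + t') := fun m => by
  have h₁ := hp m
  have h₂ : (exec (p >>= f) m).2.time ≤ (exec p m).2.time + t' := hf _ _
  omega

theorem ite {c : Prop} [Decidable c] {p q : Prog α} {t : ℕ} (hp : TimeLE p t)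
    (hq : TimeLE q t) : TimeLE (if c then p else q) t := by
  split_ifs
  exacts [hp, hq]

theorem forLoop {body : ℕ → Prog Unit} {t : ℕ} (hbody : ∀ i, TimeLE (body i) t) (n : ℕ) :
    TimeLE (Prog.forLoop n body) (n * (t + 1)) := by
  induction n with
  | zero => exact (pure ()).mono (Nat.zero_le _)
  | succ n ih => exact (ih.bind fun _ => (op ()).bind fun _ => hbody n).mono (by ring_nf; rfl)

theorem place (h Δ x : ℝ) : TimeLE (Prog.place h Δ x) 11 :=
  (op _).bind fun _ => (op _).bind fun _ => ite
    ((op _).bind fun _ => ite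
      ((op _).bind fun _ => (op _).bind fun _ => (op _).bind fun _ => (load _).bind fun _ =>
        (op _).bind fun _ => (store _ _).bind fun _ => (op _).bind fun _ => store _ _)
      ((pure ()).mono (Nat.zero_le _)))
    ((pure ()).mono (Nat.zero_le _))

theorem setup (w : ℕ) (h Δ : ℝ) : TimeLE (Prog.setup w h Δ) (w * 2 + 4) :=
  (forLoop (fun _ => store _ _) w).bind fun _ => (op _).bind fun _ => (op _).bind fun _ =>
    (store _ _).bind fun _ => store _ _

theorem keepOld (w : ℕ) : TimeLE (Prog.keepOld w) (w * 6) :=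
  forLoop (fun _ => (load _).bind fun _ => (op _).bind fun _ => ite
    ((load _).bind fun _ => (store _ _).bind fun _ => store _ _)
    ((store _ _).mono (by norm_num))) w

theorem placeShifted (w : ℕ) (h Δ s : ℝ) : TimeLE (Prog.placeShifted w h Δ s) (w * 16) :=
  forLoop (fun _ => (load _).bind fun _ => (op _).bind fun _ => ite
    ((load _).bind fun _ => (op _).bind fun _ => place _ _ _)
    ((pure ()).mono (Nat.zero_le _))) w

theorem trim (w : ℕ) : TimeLE (Prog.trim w) (w * 12) :=
  forLoop (fun _ => readCoin.bind fun _ => (load _).bind fun _ => (op _).bind fun _ => ite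
    ((op _).bind fun _ => (op _).bind fun _ => (op _).bind fun _ => (op _).bind fun _ =>
      (op _).bind fun _ => (load _).bind fun _ => (store _ _).bind fun _ => store _ _)
    ((pure ()).mono (Nat.zero_le _))) w

theorem program (w : ℕ) (B : ℝ) (n : ℕ) :
    TimeLE (Prog.program w B n) (2 * w + 6 + n * (34 * w + 2)) := by
  refine ((op _).bind fun _ => (op _).bind fun _ => (setup w _ _).bind fun _ =>
    forLoop (fun _ => readItem.bind fun _ => (keepOld w).bind fun _ =>
      (placeShifted w _ _ _).bind fun _ => trim w) n).mono (le_of_eq ?_)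
  ring

end TimeLE

end Prog

theorem runPhaseA_time_le {w : ℕ} (hw : 2 ≤ w) (B : ℝ) (s r : ℕ → ℝ) (n : ℕ) :
    (runPhaseA w B s r n).time ≤ 35 * w * (n + 1) := by
  have h : (runPhaseA w B s r n).time ≤ 0 + (2 * w + 6 + n * (34 * w + 2)) :=
    Prog.TimeLE.program w B n _
  nlinarith

theorem runPhaseA_time_le_mul_logb {w : ℕ} (hw : 2 ≤ w) (B : ℝ) (s r : ℕ → ℝ) {δ : ℝ} (h0 : 0 < δ)
    (h1 : δ < 1) {n : ℕ} (hn : (n : ℝ) ≤ 12 * Real.logb 2 w + 12 * Real.logb 2 (1 / δ) + 1) :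
    ((runPhaseA w B s r n).time : ℝ) ≤ 490 * (1 + Real.logb 2 (1 / δ)) * (w * Real.logb 2 w) := by
  have hL : 1 ≤ Real.logb 2 w := by
    rw [Real.le_logb_iff_rpow_le (by norm_num) (by positivity), Real.rpow_one]
    exact_mod_cast hw
  have hM : 0 ≤ Real.logb 2 (1 / δ) := Real.logb_nonneg (by norm_num) ((one_le_div h0).2 h1.le)
  have hcount : (n : ℝ) + 1 ≤ 14 * ((1 + Real.logb 2 (1 / δ)) * Real.logb 2 w) := by nlinarith
  calc ((runPhaseA w B s r n).time : ℝ) ≤ 35 * w * (n + 1) := by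
        exact_mod_cast runPhaseA_time_le hw B s r n
    _ ≤ 35 * w * (14 * ((1 + Real.logb 2 (1 / δ)) * Real.logb 2 w)) := by gcongr
    _ = _ := by ring

/-! ### Contents of the memory -/

theorem update_ite_lt {β : Type*} {w : ℕ} (f g : Fin w → β) (k : Fin w) :
    Function.update (fun i : Fin w => if (i : ℕ) < k then g i else f i) k (g k) =
      fun i : Fin w => if (i : ℕ) < k + 1 then g i else f i := by
  funext i
  rcases eq_or_ne i k with rfl | hik
  · simp
  · have hlt : (i : ℕ) < k + 1 ↔ (i : ℕ) < k := by
      have := Fin.val_ne_of_ne hik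
      omega
    simp only [Function.update_of_ne hik, hlt]

namespace RAM

variable {w : ℕ} {B : ℝ}

/-- The records of the `w` buckets in the memory hold the state `A` and the lists of candidates
`L`. The bound on the length of the lists makes sure that the records do not overlap. -/
structure Stores (mem : ℕ → ℝ) (A : Beam w) (L : Fin w → List ℝ) : Prop where
  flag : ∀ i : Fin w, mem (6 * i) = if (A i).isSome then 1 else 0
  anchor : ∀ (i : Fin w) (a : ℝ), A i = some a → mem (6 * i + 1) = a
  length : ∀ i : Fin w, mem (6 * i + 2) = (L i).length
  candidate : ∀ (i : Fin w) (k : ℕ) (hk : k < (L i).length), mem (6 * i + 3 + k) = (L i)[k]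
  length_le : ∀ i, (L i).length ≤ 3

namespace Stores

variable {mem mem' : ℕ → ℝ} {A : Beam w} {L : Fin w → List ℝ}

theorem empty : Stores (fun _ => 0) (fun _ : Fin w => none) fun _ => [] :=
  ⟨by simp, by simp, by simp, by simp, by simp⟩

theorem update_anchor (h : Stores mem A L) (k : Fin w) (a : ℝ) :
    Stores (Function.update (Function.update mem (6 * k + 1) a) (6 * k) 1)
      (Function.update A k (some a)) L where
  flag i := by
    rcases eq_or_ne i k with rfl | hik
    · simp
    · have := Fin.val_ne_of_ne hik
      rw [Function.update_of_ne hik, Function.update_of_ne (by omega),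
        Function.update_of_ne (by omega), h.flag]
  anchor i a' hi := by
    rcases eq_or_ne i k with rfl | hik
    · simpa using hi
    · have := Fin.val_ne_of_ne hik
      rw [Function.update_of_ne hik] at hi
      rw [Function.update_of_ne (by omega), Function.update_of_ne (by omega), h.anchor i a' hi]
  length i := by
    rw [Function.update_of_ne (by omega), Function.update_of_ne (by omega), h.length]
  candidate i j hj := by
    have := h.length_le i
    rw [Function.update_of_ne (by omega), Function.update_of_ne (by omega), h.candidate i j hj]
  length_le := h.length_le

theorem update_candidates (h : Stores mem A L) {k : Fin w} {l : List ℝ}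
    (hframe : ∀ a : ℕ, a < 6 * k + 2 ∨ 6 * k + 5 < a → mem' a = mem a) (hl : l.length ≤ 3)
    (hlength : mem' (6 * k + 2) = l.length)
    (hcandidate : ∀ j (hj : j < l.length), mem' (6 * k + 3 + j) = l[j]) :
    Stores mem' A (Function.update L k l) where
  flag i := by rw [hframe _ (by omega), h.flag]
  anchor i a hi := by rw [hframe _ (by omega), h.anchor i a hi]
  length i := by
    rcases eq_or_ne i k with rfl | hik
    · rw [Function.update_self, hlength]
    · have := Fin.val_ne_of_ne hik
      rw [Function.update_of_ne hik, hframe _ (by omega), h.length]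
  candidate i j := by
    rcases eq_or_ne i k with rfl | hik
    · simpa only [Function.update_self] using hcandidate j
    · simp only [Function.update_of_ne hik]
      intro hj
      have := Fin.val_ne_of_ne hik
      have := h.length_le i
      rw [hframe _ (by omega), h.candidate i j hj]
  length_le i := by
    rcases eq_or_ne i k with rfl | hik
    · rwa [Function.update_self]
    · rw [Function.update_of_ne hik]
      exact h.length_le i

theorem clear (h : Stores mem A L) (k : Fin w) :
    Stores (Function.update mem (6 * k + 2) 0) A (Function.update L k []) :=
  h.update_candidates (fun a ha => Function.update_of_ne (by omega) _ _) (by simp) (by simp)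
    (by simp)

theorem set_singleton (h : Stores mem A L) (k : Fin w) (a : ℝ) :
    Stores (Function.update (Function.update mem (6 * k + 3) a) (6 * k + 2) 1) A
      (Function.update L k [a]) := by
  refine h.update_candidates (fun b hb => ?_) (by simp) (by simp) fun j hj => ?_
  · rw [Function.update_of_ne (by omega), Function.update_of_ne (by omega)]
  · obtain rfl : j = 0 := by simpa using hj
    simp

theorem push (h : Stores mem A L) {k : Fin w} (hk : (L k).length ≤ 2) (x : ℝ) :
    Stores (Function.update (Function.update mem (6 * k + 3 + (L k).length) x) (6 * k + 2)
      ((L k).length + 1)) A (Function.update L k (L k ++ [x])) := by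
  refine h.update_candidates (fun b hb => ?_) (by simpa using Nat.lt_succ_of_le hk) (by simp)
    fun j hj => ?_
  · rw [Function.update_of_ne (by omega), Function.update_of_ne (by omega)]
  · rw [Function.update_of_ne (by omega)]
    rw [List.length_append, List.length_singleton] at hj
    rcases (Nat.le_of_lt_succ hj).eq_or_lt with rfl | hlt
    · simp
    · rw [Function.update_of_ne (by omega), h.candidate k j hlt, List.getElem_append_left hlt]

end Stores

/-- The machine stores `A` and `L`, has used at most `6 * w` memory cells, and has read the first
`i` of the numbers `s` and the first `c` of the random numbers `r`. -/
structure Simulates (s r : ℕ → ℝ) (i c : ℕ) (A : Beam w) (L : Fin w → List ℝ) (m : RAM) :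
    Prop where
  stores : Stores m.mem A L
  space_le : m.space ≤ 6 * w
  items_eq : m.items = s
  coins_eq : m.coins = r
  itemPos_eq : m.itemPos = i
  coinPos_eq : m.coinPos = c

theorem Simulates.tick {s r : ℕ → ℝ} {i c : ℕ} {A : Beam w} {L : Fin w → List ℝ} {m : RAM}
    (h : m.Simulates s r i c A L) : { m with time := m.time + 1 }.Simulates s r i c A L :=
  ⟨h.stores, h.space_le, h.items_eq, h.coins_eq, h.itemPos_eq, h.coinPos_eq⟩

end RAM

/-! ### Execution of the program -/

namespace Prog

variable {w : ℕ} {B : ℝ} {s r : ℕ → ℝ} {i c : ℕ} {A : Beam w} {L : Fin w → List ℝ} {m : RAM}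

section Exec

variable {α β : Type}

theorem exec_bind (p : Prog α) (f : α → Prog β) (m : RAM) :
    exec (p >>= f) m = exec (f (exec p m).1) (exec p m).2 := rfl

theorem exec_pure (a : α) (m : RAM) : exec (pure a : Prog α) m = (a, m) := rfl

theorem exec_op (a : α) (m : RAM) :
    exec (op a) m = (a, { m with time := m.time + 1 }) := rfl

theorem exec_load (a : ℕ) (m : RAM) : exec (load a) m =
    (m.mem a, { m with time := m.time + 1, space := max m.space (a + 1) }) := rfl

theorem exec_store (a : ℕ) (x : ℝ) (m : RAM) : exec (store a x) m =
    ((), { m with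
      mem := Function.update m.mem a x, time := m.time + 1, space := max m.space (a + 1) }) := rfl

theorem exec_readItem (m : RAM) : exec readItem m =
    (m.items m.itemPos, { m with time := m.time + 1, itemPos := m.itemPos + 1 }) := rfl

theorem exec_readCoin (m : RAM) : exec readCoin m =
    (m.coins m.coinPos, { m with time := m.time + 1, coinPos := m.coinPos + 1 }) := rfl

end Exec

theorem floor_add_half_div_eq (hB : 0 < B) {k : Fin w} {x : ℝ} (hx : x ∈ bucket w B k) :
    ⌊(x + B / 2) / (B / w)⌋₊ = k := by
  rw [← Int.floor_toNat, ← cell, (mem_bucket_iff_cell_eq hB k x).1 hx, Int.toNat_natCast]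

theorem mem_Ico_half_of_mem_bucket (hB : 0 < B) {k : Fin w} {x : ℝ} (hx : x ∈ bucket w B k) :
    x ∈ Set.Ico (-(B / 2)) (B / 2) := by
  rw [mem_Ico_iff_cell hB k.pos, (mem_bucket_iff_cell_eq hB k x).1 hx]
  have := k.isLt
  omega

open RAM

theorem simulates_forLoop {n : ℕ} {body : ℕ → Prog Unit} {i c : ℕ → ℕ} {A : ℕ → Beam w}
    {L : ℕ → Fin w → List ℝ} (h : m.Simulates s r (i 0) (c 0) (A 0) (L 0))
    (hbody : ∀ k < n, ∀ m : RAM, m.Simulates s r (i k) (c k) (A k) (L k) →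
      (exec (body k) m).2.Simulates s r (i (k + 1)) (c (k + 1)) (A (k + 1)) (L (k + 1))) :
    (exec (forLoop n body) m).2.Simulates s r (i n) (c n) (A n) (L n) := by
  induction n with
  | zero => exact h
  | succ n ih =>
    exact hbody n n.lt_succ_self _ (ih fun k hk => hbody k (hk.trans n.lt_succ_self)).tick

theorem simulates_setup (hB : 0 < B) (hw : 0 < w)
    (h : m.Simulates s r i c (fun _ : Fin w => none) L) :
    (exec (setup w (B / 2) (B / w)) m).2.Simulates s r i c (phaseA w B s r 0) L := by
  obtain ⟨k, hk⟩ := exists_mem_bucket hB hw (zero_mem_Ico_half hB)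
  have hphaseA : phaseA w B s r 0 = Function.update (fun _ => none) k (some 0) := by
    funext j
    rcases eq_or_ne j k with rfl | hjk
    · rw [Function.update_self, phaseA_zero_eq_some_iff]
      exact ⟨hk, rfl⟩
    · rw [Function.update_of_ne hjk, Option.eq_none_iff_forall_ne_some]
      exact fun a ha => hjk (eq_of_mem_bucket hB (phaseA_zero_eq_some_iff.1 ha).1 hk)
  have hclear : (exec (forLoop w fun j => store (6 * j) 0) m).2.Simulates s r i c
      (fun _ => none) L := by
    refine simulates_forLoop (i := fun _ => i) (c := fun _ => c) (A := fun _ _ => none)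
      (L := fun _ => L) h fun j hj m hm => ?_
    obtain ⟨hst, hsp, hit, hco, hip, hcp⟩ := hm
    have hzero : Function.update m.mem (6 * j) 0 = m.mem :=
      Function.update_eq_self_iff.2 (by simpa using (hst.flag ⟨j, hj⟩).symm)
    exact ⟨by rwa [exec_store, hzero], by rw [exec_store]; dsimp only; omega, hit, hco, hip, hcp⟩
  obtain ⟨hst, hsp, hit, hco, hip, hcp⟩ := hclear
  have hfloor : ⌊B / 2 / (B / w)⌋₊ = k := by
    rw [← floor_add_half_div_eq hB hk, zero_add]
  simp only [setup, exec_bind, div, floor, exec_op, exec_store, hfloor, hphaseA]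
  have := k.isLt
  rw [Function.update_comm (by omega)]
  exact ⟨hst.update_anchor k 0, by dsimp only; omega, hit, hco, hip, hcp⟩

/-- The body of the loop in `keepOld`. -/
noncomputable def keepOldAt (k : ℕ) : Prog Unit := do
  let f ← load (6 * k)
  if ← lt 0 f then
    let a ← load (6 * k + 1)
    store (6 * k + 3) a
    store (6 * k + 2) 1
  else
    store (6 * k + 2) 0

theorem simulates_keepOldAt (h : m.Simulates s r i c A L) (k : Fin w) :
    (exec (keepOldAt k) m).2.Simulates s r i c A (Function.update L k (A k).toList) := by
  obtain ⟨hst, hsp, hit, hco, hip, hcp⟩ := h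
  have := k.isLt
  cases hk : A k with
  | none =>
    simp only [keepOldAt, exec_bind, exec_load, lt, exec_op, hst.flag, hk, Option.isSome_none,
      Bool.false_eq_true, if_false, lt_irrefl, decide_false, exec_store]
    exact ⟨hst.clear k, by dsimp only; omega, hit, hco, hip, hcp⟩
  | some a =>
    simp only [keepOldAt, exec_bind, exec_load, lt, exec_op, hst.flag, hst.anchor k a hk, hk,
      Option.isSome_some, if_true, zero_lt_one, decide_true, exec_store]
    exact ⟨hst.set_singleton k a, by dsimp only; omega, hit, hco, hip, hcp⟩

theorem simulates_keepOld (h : m.Simulates s r i c A L) :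
    (exec (keepOld w) m).2.Simulates s r i c A fun j => (A j).toList := by
  have hloop := simulates_forLoop (body := keepOldAt) (n := w) (i := fun _ => i) (c := fun _ => c)
    (A := fun _ => A) (L := fun k j => if (j : ℕ) < k then (A j).toList else L j)
    (by simpa using h) fun k hk m hm => by
      simpa only [update_ite_lt L (fun j => (A j).toList) ⟨k, hk⟩] using
        simulates_keepOldAt hm ⟨k, hk⟩
  simp only [Fin.is_lt, if_true] at hloop
  exact hloop

open scoped Classical in
theorem simulates_place (hB : 0 < B) (hw : 0 < w) {x : ℝ} (h : m.Simulates s r i c A L)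
    (hlen : ∀ k, x ∈ bucket w B k → (L k).length ≤ 2) :
    (exec (place (B / 2) (B / w) x) m).2.Simulates s r i c A
      fun k => if x ∈ bucket w B k then L k ++ [x] else L k := by
  obtain ⟨hst, hsp, hit, hco, hip, hcp⟩ := h
  by_cases hx : x ∈ Set.Ico (-(B / 2)) (B / 2)
  · obtain ⟨k, hk⟩ := exists_mem_bucket hB hw hx
    have hL : (fun j => if x ∈ bucket w B j then L j ++ [x] else L j) =
        Function.update L k (L k ++ [x]) := by
      funext j
      rcases eq_or_ne j k with rfl | hjk
      · rw [Function.update_self, if_pos hk]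
      · rw [Function.update_of_ne hjk, if_neg fun hj => hjk (eq_of_mem_bucket hB hj hk)]
    rw [hL]
    simp only [place, exec_bind, neg, le, lt, add, div, floor, exec_op, exec_load, exec_store,
      hx.1, hx.2, decide_true, if_true, floor_add_half_div_eq hB hk, hst.length, Nat.floor_natCast]
    have := hlen k hk
    have := k.isLt
    exact ⟨hst.push (hlen k hk) x, by dsimp; omega, hit, hco, hip, hcp⟩
  · have hL : (fun j => if x ∈ bucket w B j then L j ++ [x] else L j) = L := by
      funext j
      exact if_neg fun hj => hx (mem_Ico_half_of_mem_bucket hB hj)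
    rw [hL]
    by_cases hlow : -(B / 2) ≤ x
    · have hhigh : ¬ x < B / 2 := fun hhigh => hx ⟨hlow, hhigh⟩
      simp only [place, exec_bind, neg, le, lt, exec_op, hlow, hhigh, decide_true,
        decide_false, if_true, Bool.false_eq_true, if_false, exec_pure]
      exact ⟨hst, hsp, hit, hco, hip, hcp⟩
    · simp only [place, exec_bind, neg, le, exec_op, hlow, decide_false,
        Bool.false_eq_true, if_false, exec_pure]
      exact ⟨hst, hsp, hit, hco, hip, hcp⟩

/-- The body of the loop in `placeShifted`. -/
noncomputable def placeShiftedAt (h Δ s : ℝ) (k : ℕ) : Prog Unit := do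
  let f ← load (6 * k)
  if ← lt 0 f then
    let a ← load (6 * k + 1)
    let x ← add a s
    place h Δ x

theorem simulates_placeShiftedAt (hB : 0 < B) (hA : A.Consistent B) {x : ℝ} {k : Fin w}
    (h : m.Simulates s r i c A (A.partialCandidates B x k)) :
    (exec (placeShiftedAt (B / 2) (B / w) x k) m).2.Simulates s r i c A
      (A.partialCandidates B x (k + 1)) := by
  have := k.isLt
  have hsp := h.space_le
  cases hk : A k with
  | none =>
    rw [funext (Beam.partialCandidates_succ_of_eq_none hk)]
    simp only [placeShiftedAt, exec_bind, exec_load, lt, exec_op, h.stores.flag, hk,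
      Option.isSome_none, Bool.false_eq_true, if_false, lt_irrefl, decide_false, exec_pure]
    exact ⟨h.stores, by dsimp only; omega, h.items_eq, h.coins_eq, h.itemPos_eq, h.coinPos_eq⟩
  | some a =>
    rw [funext (Beam.partialCandidates_succ_of_eq_some hk)]
    simp only [placeShiftedAt, exec_bind, exec_load, lt, add, exec_op, h.stores.flag,
      h.stores.anchor k a hk, hk, Option.isSome_some, if_true, zero_lt_one, decide_true]
    exact simulates_place hB k.pos
      ⟨h.stores, by dsimp only; omega, h.items_eq, h.coins_eq, h.itemPos_eq, h.coinPos_eq⟩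
      fun j hj => hA.length_partialCandidates_le_two hB hk hj

theorem simulates_placeShifted (hB : 0 < B) (hA : A.Consistent B) (x : ℝ)
    (h : m.Simulates s r i c A fun j => (A j).toList) :
    (exec (placeShifted w (B / 2) (B / w) x) m).2.Simulates s r i c A (A.candidates B x) := by
  rw [← funext (Beam.partialCandidates_zero (B := B) A x)] at h
  rw [← funext (hA.partialCandidates_eq_candidates hB x)]
  exact simulates_forLoop (body := placeShiftedAt (B / 2) (B / w) x) (i := fun _ => i)
    (c := fun _ => c) (A := fun _ => A) (L := A.partialCandidates B x) h
    fun k hk m hm => simulates_placeShiftedAt (k := ⟨k, hk⟩) hB hA hm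

/-- The body of the loop in `trim`. -/
noncomputable def trimAt (k : ℕ) : Prog Unit := do
  let r ← readCoin
  let c ← load (6 * k + 2)
  if ← lt 0 c then
    let y ← mul r c
    let j ← floor y
    let n ← floor c
    let n' ← predNat n
    let j' ← minNat j n'
    let a ← load (6 * k + 3 + j')
    store (6 * k + 1) a
    store (6 * k) 1

theorem simulates_trimAt {k : Fin w} (h : m.Simulates s r i c A L)
    (hk : L k = [] → A k = none) :
    (exec (trimAt k) m).2.Simulates s r i (c + 1) (Function.update A k (pick (r c) (L k))) L := by
  obtain ⟨hst, hsp, hit, hco, hip, hcp⟩ := h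
  have := k.isLt
  have := hst.length_le k
  rcases Nat.eq_zero_or_pos (L k).length with hnil | hpos
  · have hnone : pick (r c) (L k) = A k := by
      rw [hk (List.length_eq_zero_iff.1 hnil), pick_eq_none_iff, List.length_eq_zero_iff.1 hnil]
    simp only [trimAt, exec_bind, exec_readCoin, exec_load, lt, exec_op, hst.length, hnil,
      Nat.cast_zero, lt_irrefl, decide_false, Bool.false_eq_true, if_false, exec_pure, hnone,
      Function.update_eq_self]
    exact ⟨hst, by dsimp only; omega, hit, hco, hip, by dsimp only; omega⟩
  · have hpos' : (0 : ℝ) < (L k).length := by exact_mod_cast hpos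
    have hlt : min ⌊r c * (L k).length⌋₊ ((L k).length - 1) < (L k).length := by omega
    rw [pick, List.getElem?_eq_getElem hlt]
    simp only [trimAt, exec_bind, exec_readCoin, exec_load, lt, mul, floor, predNat, minNat,
      exec_op, hst.length, hpos', decide_true, if_true, exec_store, Nat.floor_natCast, hco, hcp,
      hst.candidate k _ hlt]
    exact ⟨hst.update_anchor k _, by dsimp only; omega, hit, rfl, hip, rfl⟩

theorem simulates_trim (hA : A.Consistent B) (x : ℝ)
    (h : m.Simulates s r i c A (A.candidates B x)) :
    (exec (trim w) m).2.Simulates s r i (c + w) (A.step B x fun j => r (c + j))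
      (A.candidates B x) := by
  have hloop := simulates_forLoop (body := trimAt) (n := w) (i := fun _ => i) (c := fun k => c + k)
    (A := fun k j => if (j : ℕ) < k then A.step B x (fun j => r (c + j)) j else A j)
    (L := fun _ => A.candidates B x) (by simpa using h) fun k hk m hm => by
      have hnone (hnil : A.candidates B x ⟨k, hk⟩ = []) :
          (if k < k then A.step B x (fun j => r (c + j)) ⟨k, hk⟩ else A ⟨k, hk⟩) = none := by
        rw [if_neg (lt_irrefl k)]
        exact hA.eq_none_of_candidates_eq_nil hnil
      rw [← update_ite_lt A (A.step B x fun j => r (c + j)) ⟨k, hk⟩]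
      exact simulates_trimAt (k := ⟨k, hk⟩) hm hnone
  simp only [Fin.is_lt, if_true] at hloop
  exact hloop

theorem exists_simulates_runPhaseA (hB : 0 < B) (hw : 0 < w) (s r : ℕ → ℝ) (n : ℕ) :
    ∃ L, (runPhaseA w B s r n).Simulates s r n (n * w) (phaseA w B s r n) L := by
  let L : ℕ → Fin w → List ℝ
    | 0 => fun _ => []
    | n + 1 => (phaseA w B s r n).candidates B (s n)
  refine ⟨L n, simulates_forLoop (i := id) (c := (· * w)) (A := phaseA w B s r) (L := L)
    (n := n) ?_ fun k _ m hm => ?_⟩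
  · exact (Nat.zero_mul w).symm ▸ simulates_setup hB hw
      ⟨Stores.empty, Nat.zero_le _, rfl, rfl, rfl, rfl⟩
  · have hA := consistent_phaseA w B s r k
    obtain ⟨hst, hsp, hit, hco, hip, hcp⟩ := hm
    have hread : (exec readItem m).2.Simulates s r (k + 1) (k * w) (phaseA w B s r k) (L k) :=
      ⟨hst, hsp, hit, hco, congrArg (· + 1) hip, hcp⟩
    have hitem : (exec readItem m).1 = s k := by rw [exec_readItem, hit, hip, id]
    have htrim := simulates_trim hA (s k) (simulates_placeShifted hB hA (s k)
      (simulates_keepOld hread))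
    rw [← Nat.succ_mul] at htrim
    rw [exec_bind, hitem]
    exact htrim

end Prog

theorem runPhaseA_space_le {w : ℕ} {B : ℝ} (hB : 0 < B) (hw : 0 < w) (s r : ℕ → ℝ) (n : ℕ) :
    (runPhaseA w B s r n).space ≤ 6 * w :=
  let ⟨_, h⟩ := Prog.exists_simulates_runPhaseA hB hw s r n
  h.space_le

theorem beam_runPhaseA {w : ℕ} {B : ℝ} (hB : 0 < B) (hw : 0 < w) (s r : ℕ → ℝ) (n : ℕ) :
    (runPhaseA w B s r n).beam w = phaseA w B s r n := by
  obtain ⟨L, h⟩ := Prog.exists_simulates_runPhaseA hB hw s r n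
  funext k
  rw [RAM.beam, h.stores.flag]
  cases hk : phaseA w B s r n k with
  | none => simp
  | some a => simp [h.stores.anchor k a hk]

theorem mainTheorem1_general :
    ∃ C : ℝ, 0 < C ∧
      ∀ (w : ℕ) (B : ℝ), 2 ≤ w → 0 < B →
        (∀ (s r : ℕ → ℝ) (n : ℕ),
          (runPhaseA w B s r n).beam w = phaseA w B s r n ∧
          ((runPhaseA w B s r n).time : ℝ) ≤ C * w * (n + 1) ∧
          ((runPhaseA w B s r n).space : ℝ) ≤ C * w ∧
          (phaseA w B s r n).anchors.ncard ≤ w ∧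
          (∀ a ∈ (phaseA w B s r n).anchors,
            ∃ V : Finset ℕ, V ⊆ Finset.range n ∧ a = ∑ k ∈ V, s k) ∧
          ((phaseA w B s r n).anchors.ncard = w →
            (∀ i : Fin w, ∃ a ∈ (phaseA w B s r n).anchors, a ∈ bucket w B i) ∧
            IsMesh (phaseA w B s r n).anchors B (B / w))) ∧
        (∀ (Ω : Type u) [MeasurableSpace Ω] (P : Measure Ω) [IsProbabilityMeasure P]
          (s r : ℕ → Ω → ℝ), IsAdaptiveInput P w B s r →
          ∀ δ : ℝ, 0 < δ → δ < 1 →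
            (∀ j : ℕ, jDelta w δ ≤ j →
              P.real {ω | (phaseA w B (fun k => s k ω) (fun k => r k ω) j).anchors.ncard < w}
                ≤ δ) ∧
            (jDelta w δ : ℝ) ≤
              4 * Real.log w + Real.log (w / (2 * δ)) / Real.log (8 / 7) + 1 ∧
            4 * Real.log w + Real.log (w / (2 * δ)) / Real.log (8 / 7) + 1 ≤
              (4 + 1 / Real.log (8 / 7)) * Real.log w +
                Real.log (1 / δ) / Real.log (8 / 7) + 1 ∧
            (4 + 1 / Real.log (8 / 7)) * Real.log w +
                Real.log (1 / δ) / Real.log (8 / 7) + 1 ≤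
              11.489 * Real.log w + 7.489 * Real.log (1 / δ) + 1 ∧
            (∀ ω, ((runPhaseA w B (fun k => s k ω) (fun k => r k ω) (jDelta w δ)).time : ℝ) ≤
              C * (1 + Real.logb 2 (1 / δ)) * (w * Real.logb 2 w)) ∧
            ∃ j : ℕ,
              (j : ℝ) ≤ 7.96 * Real.logb 2 w + 5.19 * Real.logb 2 (1 / δ) + 1 ∧
              P.real {ω | (phaseA w B (fun k => s k ω) (fun k => r k ω) j).anchors.ncard < w}
                ≤ δ ∧
              ∀ ω, ((runPhaseA w B (fun k => s k ω) (fun k => r k ω) j).time : ℝ) ≤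
                C * (1 + Real.logb 2 (1 / δ)) * (w * Real.logb 2 w)) := by
  refine ⟨490, by norm_num, fun w B hw hB => ⟨fun s r n => ?_, fun Ω _ P _ s r h δ h0 h1 => ?_⟩⟩
  · have hw0 : 0 < w := by omega
    have hA := consistent_phaseA w B s r n
    have htime : ((runPhaseA w B s r n).time : ℝ) ≤ 35 * w * (n + 1) := by
      exact_mod_cast runPhaseA_time_le hw B s r n
    have hspace : ((runPhaseA w B s r n).space : ℝ) ≤ 6 * w := by
      exact_mod_cast runPhaseA_space_le hB hw0 s r n
    refine ⟨beam_runPhaseA hB hw0 s r n, htime.trans (by gcongr; norm_num),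
      hspace.trans (by gcongr; norm_num), hA.ncard_anchors_le hB,
      fun a ha => exists_eq_sum_of_mem_anchors_phaseA ha, fun hfull => ?_⟩
    have hbuckets := hA.exists_anchor_mem_bucket hB hfull
    exact ⟨hbuckets, isMesh_of_forall_bucket hB hw0 hbuckets⟩
  · have hL : 0 ≤ Real.logb 2 w :=
      Real.logb_nonneg (by norm_num) (by exact_mod_cast (by omega : 1 ≤ w))
    have hM : 0 ≤ Real.logb 2 (1 / δ) := Real.logb_nonneg (by norm_num) ((one_le_div h0).2 h1.le)
    obtain ⟨j, hj, hprob⟩ := h.exists_prob_le hB hw h0 h1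
    exact ⟨fun _ => h.prob_le_of_jDelta_le hB hw h0, jDelta_le hw h0 h1,
      four_mul_log_add_log_div_le (by omega) h0, four_add_one_div_mul_log_le h0 h1,
      fun _ => runPhaseA_time_le_mul_logb hw B _ _ h0 h1 (jDelta_le_logb hw h0 h1), j, hj, hprob,
      fun _ => runPhaseA_time_le_mul_logb hw B _ _ h0 h1 (by linarith)⟩

theorem mainTheorem1 :
    ∃ C : ℝ, 0 < C ∧
      ∀ (w : ℕ) (B : ℝ), 2 ≤ w → 0 < B →
        -- for every input: correctness of the machine, its resources, and the mesh
        (∀ (s r : ℕ → ℝ) (n : ℕ),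
          (runPhaseA w B s r n).beam w = phaseA w B s r n ∧
          ((runPhaseA w B s r n).time : ℝ) ≤ C * w * (n + 1) ∧
          ((runPhaseA w B s r n).space : ℝ) ≤ C * w ∧
          (phaseA w B s r n).anchors.ncard ≤ w ∧
          (∀ a ∈ (phaseA w B s r n).anchors,
            ∃ V : Finset ℕ, V ⊆ Finset.range n ∧ a = ∑ k ∈ V, s k) ∧
          ((phaseA w B s r n).anchors.ncard = w →
            (∀ i : Fin w, ∃ a ∈ (phaseA w B s r n).anchors, a ∈ bucket w B i) ∧
            IsMesh (phaseA w B s r n).anchors B (B / w))) ∧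
        -- for random input: all buckets are filled with high probability
        (∀ (Ω : Type u) [MeasurableSpace Ω] (P : Measure Ω) [IsProbabilityMeasure P]
          (s r : ℕ → Ω → ℝ), IsPhaseAInput P B s r →
          ∀ δ : ℝ, 0 < δ → δ < 1 →
            (∀ j : ℕ, jDelta w δ ≤ j →
              P.real {ω | (phaseA w B (fun k => s k ω) (fun k => r k ω) j).anchors.ncard < w}
                ≤ δ) ∧
            (jDelta w δ : ℝ) ≤
              4 * Real.log w + Real.log (w / (2 * δ)) / Real.log (8 / 7) + 1 ∧
            4 * Real.log w + Real.log (w / (2 * δ)) / Real.log (8 / 7) + 1 ≤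
              (4 + 1 / Real.log (8 / 7)) * Real.log w +
                Real.log (1 / δ) / Real.log (8 / 7) + 1 ∧
            (4 + 1 / Real.log (8 / 7)) * Real.log w +
                Real.log (1 / δ) / Real.log (8 / 7) + 1 ≤
              11.489 * Real.log w + 7.489 * Real.log (1 / δ) + 1 ∧
            (∀ ω, ((runPhaseA w B (fun k => s k ω) (fun k => r k ω) (jDelta w δ)).time : ℝ) ≤
              C * (1 + Real.logb 2 (1 / δ)) * (w * Real.logb 2 w)) ∧
            ∃ j : ℕ,
              (j : ℝ) ≤ 7.96 * Real.logb 2 w + 5.19 * Real.logb 2 (1 / δ) + 1 ∧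
              P.real {ω | (phaseA w B (fun k => s k ω) (fun k => r k ω) j).anchors.ncard < w}
                ≤ δ ∧
              ∀ ω, ((runPhaseA w B (fun k => s k ω) (fun k => r k ω) j).time : ℝ) ≤
                C * (1 + Real.logb 2 (1 / δ)) * (w * Real.logb 2 w)) :=
  let ⟨C, hC, h⟩ := mainTheorem1_general
  ⟨C, hC, fun w B hw hB => ⟨(h w B hw hB).1, fun Ω _ P _ s r hsr =>
    (h w B hw hB).2 Ω P s r (hsr.isAdaptiveInput w)⟩⟩
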